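/- **Setting.** Two firms are located at $0\le z_1<z_2\le 1$ and simultaneously choose prices $p_1,p_2$; costs are zero. Every consumer has reservation value $1$ and linear transport cost: buying from Firm $i$ gives a consumer at $t$ the utility $1-(p_i+|t-z_i|)$, not buying gives $0$. A mass $1$ of consumers at $0$ can only buy from Firm 1, a mass $1$ of consumers at $1$ can only buy from Firm 2, and a mass $1$ of informed consumers, uniform on $(0,1)$, buy one unit from the firm that offers the higher utility if this utility is nonnegative; the demand of indifferent consumers is split equally. A *price equilibrium* with profits $\pi_1^\star,\pi_2^\star$ is a pair of probability distributions of prices such that, against the rival's distribution, Firm $i$'s expected profit under its own distribution is $\pi_i^\star$ and no price gives it more than $\pi_i^\star$. Let $\mathrm{Ei}(x)=\int_{-\infty}^x \frac{e^t}{t}\,dt$ (principal value for $x>0$), $\lambda_2=\frac1{2(1-z_2)}$, $\delta=z_2-z_1$, $$g_0(p;b)=1+\frac{2}{3-z_1-2z_2-b}\,e^{-\lambda_2(b-p)},$$ $$g_\pi(p;b)=\frac{2\lambda_2}{p+\delta}-\frac{2\lambda_2}{b+\delta}\,\frac{1-z_1-b}{3-z_1-2z_2-b}\,e^{-\lambda_2(b-p)}-2\lambda_2^2e^{\lambda_2(p+\delta)}\bigl(\mathrm{Ei}(-\lambda_2(b+\delta))-\mathrm{Ei}(-\lambda_2(p+\delta))\bigr),$$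 $$g(p;b,\pi)=g_0(p;b)-\pi\,g_\pi(p;b),$$ $$h(p;a)=4\lambda_2e^{-\lambda_2(p-a)}-\frac{4\lambda_2(a-\delta)}{p-\delta}+4\lambda_2^2(a-\delta)e^{-\lambda_2(p-\delta)}\bigl(\mathrm{Ei}(\lambda_2(p-\delta))-\mathrm{Ei}(\lambda_2(a-\delta))\bigr).$$ **Proposition.** Assume $z_1\le\frac12$, $z_1+z_2\ge1$ and $(1-z_1)\left(\frac12+z_1+z_2\right)<2z_1$. Let $0<w<z_1$ satisfy $$\frac1{2\lambda_2}h(z_2;z_2-w)+z_1+z_2+\frac12-\frac{2w}{z_1}=\frac{2(z_1-w)}{1-z_1}$$ and $$2-\frac w2-\Bigl(\frac32-z_2\Bigr)g_0(z_1;z_1)+\Bigl(\frac{w}{z_2(z_2-w)}+\Bigl(\frac32-z_2\Bigr)g_\pi(z_1;z_1)-\frac1{1-z_2}\Bigr)\frac{g_0(z_1-w;z_1)}{g_\pi(z_1-w;z_1)}\le0.$$ Put $\pi_1^\star=2(z_1-w)$ and $\pi_2^\star=\frac{g_0(z_1-w;z_1)}{g_\pi(z_1-w;z_1)}$, and assume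 $g(z_1;z_1,\pi_2^\star)\le1$, i.e. that the mass $1-g(z_1;z_1,\pi_2^\star)$ assigned to the price $1-z_1$ below is nonnegative. Then $$F_1^\star(p)=\begin{cases}0,&p<z_1-w,\\ g(p;z_1,\pi_2^\star),&z_1-w\le p<z_1,\\ g(z_1;z_1,\pi_2^\star),&z_1\le p<1-z_1,\\ 1,&p\ge1-z_1,\end{cases}\qquad F_2^\star(p)=\begin{cases}0,&p<z_2-w,\\ h(p;z_2-w),&z_2-w\le p<z_2,\\ 1,&p\ge z_2,\end{cases}$$ are cumulative distribution functions of probability measures on $\mathbb R$, and the pair of these measures (for Firm 1 and Firm 2) is a price equilibrium with profits $\pi_1^\star$ and $\pi_2^\star$. -/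

import Mathlib

open MeasureTheory Filter Topology

noncomputable section

namespace CaptiveHotelling

/-! ### The price game -/

/-- Utility of a consumer located at `t` who buys at price `p` from a firm located at `z`
(reservation value `1`, linear transport cost). Not buying yields utility `0`. -/
def utility (z p t : ℝ) : ℝ := 1 - (p + |t - z|)

/-- The quantity that an informed consumer located at `t` buys from the firm at location `z` with
price `p`, when the rival is at location `z'` with price `p'`: the consumer buys one unit from the
firm offering the higher utility, provided that this utility is nonnegative; an indifferent
consumer's demand is split equally. -/
def informedDemand (z p z' p' t : ℝ) : ℝ :=
  if utility z p t < 0 then 0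
  else if utility z' p' t < utility z p t then 1
  else if utility z' p' t = utility z p t then 1 / 2
  else 0

/-- The quantity that the captive consumers (mass one, located at `c`) buy from their firm, which is
at location `z` with price `p`. -/
def captiveDemand (c z p : ℝ) : ℝ := if 0 ≤ utility z p c then 1 else 0

/-- Profit of the firm at location `z` with price `p`, whose captive consumers are located at `c`,
when the rival is at location `z'` with price `p'`. Informed consumers are uniform on `(0, 1)`. -/
def profit (c z p z' p' : ℝ) : ℝ :=
  p * (captiveDemand c z p + ∫ t in Set.Ioo (0 : ℝ) 1, informedDemand z p z' p' t)

/-- Expected profit of Firm 1 (captive consumers at `0`) when it charges `p₁` and Firm 2's price is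
drawn from `μ₂`. -/
def expectedProfit₁ (z₁ z₂ : ℝ) (μ₂ : Measure ℝ) (p₁ : ℝ) : ℝ :=
  ∫ p₂, profit 0 z₁ p₁ z₂ p₂ ∂μ₂

/-- Expected profit of Firm 2 (captive consumers at `1`) when it charges `p₂` and Firm 1's price is
drawn from `μ₁`. -/
def expectedProfit₂ (z₁ z₂ : ℝ) (μ₁ : Measure ℝ) (p₂ : ℝ) : ℝ :=
  ∫ p₁, profit 1 z₂ p₂ z₁ p₁ ∂μ₁

/-- `(μ₁, μ₂)` is a mixed-strategy (Nash) equilibrium of the price game at locations `(z₁, z₂)`, with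
equilibrium profits `π₁` and `π₂`: the expected profits exist, the firms earn `π₁` and `π₂`, and no
price whatsoever gives a firm more against the rival's mixed strategy. -/
structure IsPriceEquilibrium (z₁ z₂ : ℝ) (μ₁ μ₂ : Measure ℝ) (π₁ π₂ : ℝ) : Prop where
  isProbabilityMeasure₁ : IsProbabilityMeasure μ₁
  isProbabilityMeasure₂ : IsProbabilityMeasure μ₂
  integrable_profit₁ : ∀ p₁, Integrable (fun p₂ => profit 0 z₁ p₁ z₂ p₂) μ₂
  integrable_profit₂ : ∀ p₂, Integrable (fun p₁ => profit 1 z₂ p₂ z₁ p₁) μ₁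
  integrable_expectedProfit₁ : Integrable (expectedProfit₁ z₁ z₂ μ₂) μ₁
  integrable_expectedProfit₂ : Integrable (expectedProfit₂ z₁ z₂ μ₁) μ₂
  payoff₁ : ∫ p₁, expectedProfit₁ z₁ z₂ μ₂ p₁ ∂μ₁ = π₁
  payoff₂ : ∫ p₂, expectedProfit₂ z₁ z₂ μ₁ p₂ ∂μ₂ = π₂
  no_deviation₁ : ∀ p₁, expectedProfit₁ z₁ z₂ μ₂ p₁ ≤ π₁
  no_deviation₂ : ∀ p₂, expectedProfit₂ z₁ z₂ μ₁ p₂ ≤ π₂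

/-! ### The functions that describe the equilibrium -/

/-- The exponential integral `∫_{-∞}^x exp t / t dt`, as a Cauchy principal value at `0` when
`0 < x`. -/
def Ei (x : ℝ) : ℝ :=
  limUnder (𝓝[>] (0 : ℝ)) fun ε => ∫ t in Set.Iic x \ Set.Ioo (-ε) ε, Real.exp t / t

/-- The constant `λ₂`. -/
def lam (z₂ : ℝ) : ℝ := 1 / (2 * (1 - z₂))

/-- The distance `δ` between the firms. -/
def dist₁₂ (z₁ z₂ : ℝ) : ℝ := z₂ - z₁

/-- `g₀(p; b)`. -/
def g₀ (z₁ z₂ p b : ℝ) : ℝ :=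
  1 + 2 / (3 - z₁ - 2 * z₂ - b) * Real.exp (-lam z₂ * (b - p))

/-- `g_π(p; b)`. -/
def gπ (z₁ z₂ p b : ℝ) : ℝ :=
  2 * lam z₂ / (p + dist₁₂ z₁ z₂)
    - 2 * lam z₂ / (b + dist₁₂ z₁ z₂) * ((1 - z₁ - b) / (3 - z₁ - 2 * z₂ - b))
        * Real.exp (-lam z₂ * (b - p))
    - 2 * lam z₂ ^ 2 * Real.exp (lam z₂ * (p + dist₁₂ z₁ z₂))
        * (Ei (-lam z₂ * (b + dist₁₂ z₁ z₂)) - Ei (-lam z₂ * (p + dist₁₂ z₁ z₂)))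

/-- `g(p; b, π)`. -/
def g (z₁ z₂ p b π : ℝ) : ℝ := g₀ z₁ z₂ p b - π * gπ z₁ z₂ p b

/-- `h(p; a)`. -/
def h (z₁ z₂ p a : ℝ) : ℝ :=
  4 * lam z₂ * Real.exp (-lam z₂ * (p - a))
    - 4 * lam z₂ * (a - dist₁₂ z₁ z₂) / (p - dist₁₂ z₁ z₂)
    + 4 * lam z₂ ^ 2 * (a - dist₁₂ z₁ z₂) * Real.exp (-lam z₂ * (p - dist₁₂ z₁ z₂))
        * (Ei (lam z₂ * (p - dist₁₂ z₁ z₂)) - Ei (lam z₂ * (a - dist₁₂ z₁ z₂)))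

/-- The equilibrium profit of Firm 1. -/
def profitStar₁ (z₁ w : ℝ) : ℝ := 2 * (z₁ - w)

/-- The equilibrium profit of Firm 2. -/
def profitStar₂ (z₁ z₂ w : ℝ) : ℝ := g₀ z₁ z₂ (z₁ - w) z₁ / gπ z₁ z₂ (z₁ - w) z₁

/-- The cumulative distribution function of Firm 1's price (right-continuous version). -/
def F₁ (z₁ z₂ w p : ℝ) : ℝ :=
  if p < z₁ - w then 0
  else if p < z₁ then g z₁ z₂ p z₁ (profitStar₂ z₁ z₂ w)
  else if p < 1 - z₁ then g z₁ z₂ z₁ z₁ (profitStar₂ z₁ z₂ w)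
  else 1

/-- The cumulative distribution function of Firm 2's price (right-continuous version). -/
def F₂ (z₁ z₂ w p : ℝ) : ℝ :=
  if p < z₂ - w then 0
  else if p < z₂ then h z₁ z₂ p (z₂ - w)
  else 1

end CaptiveHotelling

end

noncomputable section

namespace CaptiveHotelling

/-! ### The exponential integral -/

/-! Write `δ` for the distance between the firms. Against a rival price `s`, a firm with price `p`
undercuts and serves everybody, shares the informed consumers at an indifferent one, or is undercut
and keeps only its captives; the regime changes where `p` and `s` differ by `δ`. For fixed `p` the
profit is affine in `s` within each regime. Constancy of a firm's expected profit on an interval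
amounts to a linear first-order equation for the rival's distribution. `h` and `g` solve these
equations (`hasDerivAt_h`, `hasDerivAt_g`), the exponential integral arising by variation of
constants.

The equations also give closed antiderivatives of (affine function) × (density), so expected profits
are computed exactly (`expectedProfit₁_support`, `expectedProfit₂_support`). The constants are fixed
at the ends: the equation for `w` makes Firm 1 indifferent between its interval and `1 - z₁`, the
highest price its captives accept; the definition of `π₂` makes `g` vanish at `z₁ - w`. The tempting
deviation is for Firm 2 to undercut the atom at `1 - z₁` with a price just below `1 - z₂`. The
inequality in `w` excludes it, and lower prices do no better (`expectedProfit₂_low`); all other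
prices are dominated.

That the two functions are distribution functions rests on `w ≤ 3 * z₁ / 4`. The deviation
inequality yields `w ≤ 2 * z₂ - 1`, comparison with a constant-coefficient equation then yields `w ≤
9 / 28` (`width_le`), and the region forces `3 / 7 < z₁`. Signs of the densities propagate leftwards
from the right ends. `EquilibriumData` separates these facts from the game-theoretic argument. -/

theorem integrableOn_exp_div_Iic {x : ℝ} (hx : x < 0) :
    IntegrableOn (fun t => Real.exp t / t) (Set.Iic x) := by
  refine Integrable.mono' ((integrableOn_exp_Iic x).div_const (-x))
    ((Real.measurable_exp.div measurable_id).aestronglyMeasurable) ?_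
  filter_upwards [ae_restrict_mem measurableSet_Iic] with t ht
  have ht' : t ≤ x := ht
  rw [norm_div, Real.norm_eq_abs, Real.norm_eq_abs, abs_of_pos (Real.exp_pos t),
    abs_of_neg (ht'.trans_lt hx)]
  gcongr
  linarith

theorem intervalIntegrable_exp_div {a b : ℝ} (h : (0 : ℝ) ∉ Set.uIcc a b) :
    IntervalIntegrable (fun t => Real.exp t / t) volume a b := by
  apply ContinuousOn.intervalIntegrable
  apply ContinuousOn.div Real.continuous_exp.continuousOn continuousOn_id
  rintro x hx rfl
  exact h hx

theorem Ei_of_neg {x : ℝ} (hx : x < 0) : Ei x = ∫ t in Set.Iic x, Real.exp t / t := by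
  apply Tendsto.limUnder_eq
  apply tendsto_const_nhds.congr'
  filter_upwards [Ioo_mem_nhdsGT (show (0 : ℝ) < -x by linarith)] with ε hε
  congr 2
  ext t
  simp only [Set.mem_Iic, Set.mem_sdiff, Set.mem_Ioo, not_and, not_lt]
  constructor
  · intro h
    exact ⟨h, fun h2 => by linarith [hε.2]⟩
  · exact fun h => h.1

theorem continuous_dslope_exp : Continuous (dslope Real.exp 0) := by
  rw [← continuousOn_univ, continuousOn_dslope univ_mem]
  exact ⟨Real.continuous_exp.continuousOn, Real.differentiableAt_exp⟩

theorem exp_div_eq_dslope_add_inv {t : ℝ} (ht : t ≠ 0) :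
    Real.exp t / t = dslope Real.exp 0 t + t⁻¹ := by
  rw [dslope_of_ne _ ht, slope_def_field, Real.exp_zero]
  field_simp
  ring

/-- The integrand is a continuous function plus `1 / t`, and the odd part cancels over the symmetric
pair of intervals. This is the existence of the principal value. -/
theorem integral_exp_div_symm {ε : ℝ} (hε : 0 < ε) :
    (∫ t in (-1)..(-ε), Real.exp t / t) + (∫ t in ε..1, Real.exp t / t)
      = (∫ t in (-1)..(-ε), dslope Real.exp 0 t) + ∫ t in ε..1, dslope Real.exp 0 t := by
  have h1 : (0 : ℝ) ∉ Set.uIcc (-1) (-ε) := Set.notMem_uIcc_of_gt (by norm_num) (by linarith)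
  have h2 : (0 : ℝ) ∉ Set.uIcc ε 1 := Set.notMem_uIcc_of_lt hε (by norm_num)
  have e : ∀ a b : ℝ, (0 : ℝ) ∉ Set.uIcc a b → (∫ t in a..b, Real.exp t / t)
      = (∫ t in a..b, dslope Real.exp 0 t) + ∫ t in a..b, t⁻¹ := by
    intro a b hab
    rw [← intervalIntegral.integral_add (continuous_dslope_exp.intervalIntegrable _ _)]
    · apply intervalIntegral.integral_congr
      intro t ht
      exact exp_div_eq_dslope_add_inv (fun h => hab (h ▸ ht))
    · exact intervalIntegral.intervalIntegrable_inv (fun t ht h => hab (h ▸ ht)) continuousOn_id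
  rw [e _ _ h1, e _ _ h2, integral_inv_of_neg (by norm_num) (by linarith),
    integral_inv_of_pos hε (by norm_num)]
  have : -ε / -1 = ε := by ring
  rw [this, one_div, Real.log_inv]
  ring

theorem Ei_of_pos {x : ℝ} (hx : 0 < x) :
    Ei x = (∫ t in Set.Iic (-1 : ℝ), Real.exp t / t) + (∫ t in (-1)..0, dslope Real.exp 0 t)
      + (∫ t in (0 : ℝ)..1, dslope Real.exp 0 t) + ∫ t in (1 : ℝ)..x, Real.exp t / t := by
  apply Tendsto.limUnder_eq
  have hlim : Tendsto (fun ε : ℝ => (∫ t in Set.Iic (-1 : ℝ), Real.exp t / t)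
      + (∫ t in (-1)..(-ε), dslope Real.exp 0 t)
      + (∫ t in ε..1, dslope Real.exp 0 t) + ∫ t in (1 : ℝ)..x, Real.exp t / t) (𝓝 0)
      (𝓝 ((∫ t in Set.Iic (-1 : ℝ), Real.exp t / t) + (∫ t in (-1)..(-0), dslope Real.exp 0 t)
      + (∫ t in (0 : ℝ)..1, dslope Real.exp 0 t) + ∫ t in (1 : ℝ)..x, Real.exp t / t)) := by
    have hc : Continuous fun u : ℝ => ∫ t in (1 : ℝ)..u, dslope Real.exp 0 t :=
      intervalIntegral.continuous_primitive (fun a b => continuous_dslope_exp.intervalIntegrable a b) _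
    have hc' : Continuous fun u : ℝ => ∫ t in (-1 : ℝ)..u, dslope Real.exp 0 t :=
      intervalIntegral.continuous_primitive (fun a b => continuous_dslope_exp.intervalIntegrable a b) _
    have hc2 : Continuous fun u : ℝ => ∫ t in u..1, dslope Real.exp 0 t := by
      have : (fun u : ℝ => ∫ t in u..1, dslope Real.exp 0 t)
          = fun u => -∫ t in (1 : ℝ)..u, dslope Real.exp 0 t := by
        funext u
        rw [intervalIntegral.integral_symm]
      rw [this]
      exact hc.neg
    refine (((tendsto_const_nhds.add ?_).add ?_).add tendsto_const_nhds)
    · exact (hc'.comp continuous_neg).tendsto 0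
    · exact hc2.tendsto 0
  rw [neg_zero] at hlim
  refine (hlim.mono_left nhdsWithin_le_nhds).congr' ?_
  filter_upwards [Ioo_mem_nhdsGT hx] with ε hε
  have h1 : (0 : ℝ) ∉ Set.uIcc ε 1 := Set.notMem_uIcc_of_lt hε.1 (by norm_num)
  have h2 : (0 : ℝ) ∉ Set.uIcc 1 x := Set.notMem_uIcc_of_lt (by norm_num) hx
  have h3 : (0 : ℝ) ∉ Set.uIcc ε x := Set.notMem_uIcc_of_lt hε.1 hx
  have hset : Set.Iic x \ Set.Ioo (-ε) ε = Set.Iic (-ε) ∪ Set.Icc ε x := by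
    ext t
    simp only [Set.mem_Iic, Set.mem_sdiff, Set.mem_Ioo, not_and, not_lt, Set.mem_union, Set.mem_Icc]
    constructor
    · rintro ⟨h, h'⟩
      by_cases h0 : t ≤ -ε
      · exact Or.inl h0
      · exact Or.inr ⟨h' (by linarith), h⟩
    · rintro (h | h)
      · exact ⟨by linarith [hε.1], fun h' => by linarith⟩
      · exact ⟨h.2, fun _ => h.1⟩
  rw [hset, setIntegral_union, integral_Icc_eq_integral_Ioc,
    ← intervalIntegral.integral_of_le hε.2.le,
    ← intervalIntegral.integral_add_adjacent_intervals (intervalIntegrable_exp_div h1)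
      (intervalIntegrable_exp_div h2)]
  · have := intervalIntegral.integral_Iic_sub_Iic
      (integrableOn_exp_div_Iic (show (-1 : ℝ) < 0 by norm_num))
      (integrableOn_exp_div_Iic (show -ε < 0 by linarith [hε.1]))
    have h5 := integral_exp_div_symm hε.1
    linarith
  · rw [Set.disjoint_left]
    intro t ht ht'
    have : t ≤ -ε := ht
    linarith [ht'.1, hε.1]
  · exact measurableSet_Icc
  · exact integrableOn_exp_div_Iic (by linarith [hε.1])
  · rw [integrableOn_Icc_iff_integrableOn_Ioc, ← intervalIntegrable_iff_integrableOn_Ioc_of_le hε.2.le]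
    exact intervalIntegrable_exp_div h3

theorem hasDerivAt_integral_exp_div {a x : ℝ} (h : (0 : ℝ) ∉ Set.uIcc a x) :
    HasDerivAt (fun u => ∫ t in a..u, Real.exp t / t) (Real.exp x / x) x := by
  have hx : x ≠ 0 := fun h' => h (h' ▸ Set.right_mem_uIcc)
  refine intervalIntegral.integral_hasDerivAt_right (intervalIntegrable_exp_div h) ?_ ?_
  · exact (Real.measurable_exp.div measurable_id).stronglyMeasurable.stronglyMeasurableAtFilter
  · exact Real.continuous_exp.continuousAt.div continuousAt_id hx

theorem hasDerivAt_Ei {x : ℝ} (hx : x ≠ 0) : HasDerivAt Ei (Real.exp x / x) x := by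
  rcases hx.lt_or_gt with hx | hx
  · have h := (hasDerivAt_integral_exp_div (a := -1)
      (Set.notMem_uIcc_of_gt (by norm_num) hx)).const_add
        (∫ t in Set.Iic (-1 : ℝ), Real.exp t / t)
    refine h.congr_of_eventuallyEq ?_
    filter_upwards [Iio_mem_nhds hx] with u hu
    rw [Ei_of_neg hu]
    have := intervalIntegral.integral_Iic_sub_Iic
      (integrableOn_exp_div_Iic (show (-1 : ℝ) < 0 by norm_num)) (integrableOn_exp_div_Iic hu)
    linarith
  · have h := (hasDerivAt_integral_exp_div (a := 1)
      (Set.notMem_uIcc_of_lt (by norm_num) hx)).const_add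
        ((∫ t in Set.Iic (-1 : ℝ), Real.exp t / t) + (∫ t in (-1)..0, dslope Real.exp 0 t)
      + (∫ t in (0 : ℝ)..1, dslope Real.exp 0 t))
    refine h.congr_of_eventuallyEq ?_
    filter_upwards [Ioi_mem_nhds hx] with u hu
    exact Ei_of_pos hu

/-! ### The differential equations of `h` and `g` -/

/-- Variation of constants: the exponential in front of `Ei` cancels the one in the derivative of
`Ei`, leaving a multiple of `1 / (p - δ)` that matches the second summand of `h`. -/
theorem hasDerivAt_h {z₁ z₂ p a : ℝ} (hp : 0 < p - dist₁₂ z₁ z₂) (hl : lam z₂ ≠ 0) :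
    HasDerivAt (fun p => h z₁ z₂ p a)
      (4 * lam z₂ * (a - dist₁₂ z₁ z₂) / (p - dist₁₂ z₁ z₂) ^ 2 - lam z₂ * h z₁ z₂ p a) p := by
  have hq : p - dist₁₂ z₁ z₂ ≠ 0 := hp.ne'
  have d0 : HasDerivAt (fun p => p - dist₁₂ z₁ z₂) 1 p := (hasDerivAt_id p).sub_const _
  have d1 : HasDerivAt (fun p => lam z₂ * (p - dist₁₂ z₁ z₂)) (lam z₂ * 1) p := d0.const_mul _
  have d2 := (hasDerivAt_Ei (mul_ne_zero hl hq)).comp p d1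
  have d3 := (((hasDerivAt_id p).sub_const a).const_mul (-lam z₂)).exp
  have d4 := (d0.const_mul (-lam z₂)).exp
  have d5 := d0.fun_inv hq
  have d := ((d3.const_mul (4 * lam z₂)).sub (d5.const_mul (4 * lam z₂ * (a - dist₁₂ z₁ z₂)))).add
    ((d4.const_mul (4 * lam z₂ ^ 2 * (a - dist₁₂ z₁ z₂))).mul
      (d2.sub_const (Ei (lam z₂ * (a - dist₁₂ z₁ z₂)))))
  have e : Real.exp (-lam z₂ * (p - dist₁₂ z₁ z₂)) = (Real.exp (lam z₂ * (p - dist₁₂ z₁ z₂)))⁻¹ := by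
    rw [← Real.exp_neg]; ring_nf
  refine (d.congr_of_eventuallyEq (Eventually.of_forall fun x => ?_)).congr_deriv ?_
  · simp [h, div_eq_mul_inv]
  · simp only [h, Function.comp_def, id]
    rw [e]
    have := Real.exp_ne_zero (lam z₂ * (p - dist₁₂ z₁ z₂))
    field_simp
    ring

theorem hasDerivAt_g {z₁ z₂ p b π : ℝ} (hp : 0 < p + dist₁₂ z₁ z₂) (hl : lam z₂ ≠ 0) :
    HasDerivAt (fun p => g z₁ z₂ p b π)
      (lam z₂ * (g z₁ z₂ p b π - 1) + 2 * lam z₂ * π / (p + dist₁₂ z₁ z₂) ^ 2) p := by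
  have hq : p + dist₁₂ z₁ z₂ ≠ 0 := hp.ne'
  have d0 : HasDerivAt (fun p => p + dist₁₂ z₁ z₂) 1 p := (hasDerivAt_id p).add_const _
  have d1 : HasDerivAt (fun p => -lam z₂ * (p + dist₁₂ z₁ z₂)) (-lam z₂ * 1) p := d0.const_mul _
  have d2 := (hasDerivAt_Ei (mul_ne_zero (neg_ne_zero.2 hl) hq)).comp p d1
  have d3 := (((hasDerivAt_id p).const_sub b).const_mul (-lam z₂)).exp
  have d4 := (d0.const_mul (lam z₂)).exp
  have d5 := d0.fun_inv hq
  have dg0 := (d3.const_mul (2 / (3 - z₁ - 2 * z₂ - b))).const_add 1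
  have dgp := ((d5.const_mul (2 * lam z₂)).sub (d3.const_mul (2 * lam z₂ / (b + dist₁₂ z₁ z₂)
    * ((1 - z₁ - b) / (3 - z₁ - 2 * z₂ - b))))).sub
    ((d4.const_mul (2 * lam z₂ ^ 2)).mul
      (d2.const_sub (Ei (-lam z₂ * (b + dist₁₂ z₁ z₂)))))
  have d := dg0.sub (dgp.const_mul π)
  have e : Real.exp (-lam z₂ * (p + dist₁₂ z₁ z₂)) = (Real.exp (lam z₂ * (p + dist₁₂ z₁ z₂)))⁻¹ := by
    rw [← Real.exp_neg]; ring_nf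
  refine (d.congr_of_eventuallyEq (Eventually.of_forall fun x => ?_)).congr_deriv ?_
  · simp [g, g₀, gπ, div_eq_mul_inv]
  · simp only [g, g₀, gπ, Function.comp_def, id]
    rw [e]
    have := Real.exp_ne_zero (lam z₂ * (p + dist₁₂ z₁ z₂))
    -- These coefficients are constant in `p`; hiding them spares `field_simp` denominators not
    -- known to be nonzero.
    generalize (2 / (3 - z₁ - 2 * z₂ - b)) = A
    generalize (2 * lam z₂ / (b + dist₁₂ z₁ z₂) * ((1 - z₁ - b) / (3 - z₁ - 2 * z₂ - b))) = B
    field_simp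
    ring

end CaptiveHotelling

namespace CaptiveHotelling

/-! ### Demand and profit -/

theorem informedDemand_nonneg (z p z' p' t : ℝ) : 0 ≤ informedDemand z p z' p' t := by
  unfold informedDemand
  split_ifs <;> norm_num

theorem informedDemand_le_one (z p z' p' t : ℝ) : informedDemand z p z' p' t ≤ 1 := by
  unfold informedDemand
  split_ifs <;> norm_num

theorem informedDemand_eq_one {z p z' p' t : ℝ} (h0 : 0 ≤ utility z p t)
    (h : utility z' p' t < utility z p t) : informedDemand z p z' p' t = 1 := by
  rw [informedDemand, if_neg h0.not_gt, if_pos h]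

theorem informedDemand_eq_zero {z p z' p' t : ℝ} (h : utility z p t < utility z' p' t) :
    informedDemand z p z' p' t = 0 := by
  rw [informedDemand, if_neg h.not_gt, if_neg h.ne']
  split_ifs <;> rfl

theorem informedDemand_of_utility_neg {z p z' p' t : ℝ} (h : utility z p t < 0) :
    informedDemand z p z' p' t = 0 := by
  rw [informedDemand, if_pos h]

theorem measurable_utility (z : ℝ) : Measurable fun x : ℝ × ℝ => utility z x.1 x.2 := by
  unfold utility
  fun_prop

theorem measurable_informedDemand (z z' : ℝ) :
    Measurable fun x : (ℝ × ℝ) × ℝ => informedDemand z x.1.1 z' x.1.2 x.2 := by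
  have h1 : Measurable fun x : (ℝ × ℝ) × ℝ => utility z x.1.1 x.2 :=
    (measurable_utility z).comp (by fun_prop : Measurable fun x : (ℝ × ℝ) × ℝ => (x.1.1, x.2))
  have h2 : Measurable fun x : (ℝ × ℝ) × ℝ => utility z' x.1.2 x.2 :=
    (measurable_utility z').comp (by fun_prop : Measurable fun x : (ℝ × ℝ) × ℝ => (x.1.2, x.2))
  unfold informedDemand
  refine Measurable.ite (measurableSet_lt h1 measurable_const) measurable_const
    (Measurable.ite (measurableSet_lt h2 h1) measurable_const
      (Measurable.ite (measurableSet_eq_fun h2 h1) measurable_const measurable_const))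

theorem integrableOn_informedDemand (z p z' p' : ℝ) :
    IntegrableOn (informedDemand z p z' p') (Set.Ioo 0 1) := by
  have hm : Measurable (informedDemand z p z' p') :=
    (measurable_informedDemand z z').comp
      (by fun_prop : Measurable fun t : ℝ => ((p, p'), t))
  refine Integrable.mono' (integrable_const (1 : ℝ)) hm.aestronglyMeasurable ?_
  refine Eventually.of_forall fun t => ?_
  rw [Real.norm_eq_abs, abs_of_nonneg (informedDemand_nonneg ..)]
  exact informedDemand_le_one ..

theorem measurable_profit (c z z' : ℝ) : Measurable fun x : ℝ × ℝ => profit c z x.1 z' x.2 := by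
  unfold profit
  refine measurable_fst.mul (Measurable.add ?_ ?_)
  · have h1 : Measurable fun x : ℝ × ℝ => utility z x.1 c := by
      unfold utility
      fun_prop
    exact Measurable.ite (measurableSet_le measurable_const h1) measurable_const measurable_const
  · exact (StronglyMeasurable.integral_prod_right
      (f := fun (x : ℝ × ℝ) t => informedDemand z x.1 z' x.2 t)
      (measurable_informedDemand z z').stronglyMeasurable).measurable

/-- The quantity sold to the informed consumers. -/
def informedSales (z p z' p' : ℝ) : ℝ := ∫ t in Set.Ioo (0 : ℝ) 1, informedDemand z p z' p' t

theorem profit_eq (c z p z' p' : ℝ) :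
    profit c z p z' p' = p * (captiveDemand c z p + informedSales z p z' p') := rfl

theorem informedSales_nonneg (z p z' p' : ℝ) : 0 ≤ informedSales z p z' p' :=
  integral_nonneg fun _ => informedDemand_nonneg ..

theorem informedSales_le_one (z p z' p' : ℝ) : informedSales z p z' p' ≤ 1 := by
  unfold informedSales
  calc _ ≤ ∫ t in Set.Ioo (0 : ℝ) 1, (1 : ℝ) :=
        integral_mono (integrableOn_informedDemand ..) (integrable_const _)
          fun t => informedDemand_le_one ..
    _ = 1 := by simp

theorem captiveDemand_nonneg (c z p : ℝ) : 0 ≤ captiveDemand c z p := by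
  unfold captiveDemand
  split_ifs <;> norm_num

theorem captiveDemand_le_one (c z p : ℝ) : captiveDemand c z p ≤ 1 := by
  unfold captiveDemand
  split_ifs <;> norm_num

theorem captiveDemand_zero_of_le {x p : ℝ} (hx : 0 ≤ x) (h : p + x ≤ 1) :
    captiveDemand 0 x p = 1 := by
  unfold captiveDemand utility
  rw [zero_sub, abs_neg, abs_of_nonneg hx, if_pos (by linarith)]

theorem captiveDemand_zero_of_lt {x p : ℝ} (hx : 0 ≤ x) (h : 1 < p + x) :
    captiveDemand 0 x p = 0 := by
  unfold captiveDemand utility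
  rw [zero_sub, abs_neg, abs_of_nonneg hx, if_neg (by linarith)]

theorem profit_le_two_mul {c z p z' p' : ℝ} (hp : 0 ≤ p) : profit c z p z' p' ≤ 2 * p := by
  rw [profit_eq]
  nlinarith [captiveDemand_le_one c z p, informedSales_le_one z p z' p']

theorem profit_nonpos {c z p z' p' : ℝ} (hp : p ≤ 0) : profit c z p z' p' ≤ 0 := by
  rw [profit_eq]
  exact mul_nonpos_of_nonpos_of_nonneg hp
    (add_nonneg (captiveDemand_nonneg ..) (informedSales_nonneg ..))

theorem abs_profit_le (c z p z' p' : ℝ) : |profit c z p z' p'| ≤ 2 * |p| := by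
  rw [profit_eq, abs_mul, abs_of_nonneg (add_nonneg (captiveDemand_nonneg ..)
    (informedSales_nonneg ..))]
  nlinarith [captiveDemand_le_one c z p, informedSales_le_one z p z' p', abs_nonneg p]

theorem informedSales_antitone {z p q z' p' : ℝ} (h : p ≤ q) :
    informedSales z q z' p' ≤ informedSales z p z' p' := by
  refine integral_mono (integrableOn_informedDemand ..) (integrableOn_informedDemand ..) fun t => ?_
  have hu : utility z q t ≤ utility z p t := by unfold utility; linarith
  unfold informedDemand
  split_ifs <;> first | (norm_num; done) | (exfalso; grind)

theorem informedSales_of_one_lt {z p z' p' : ℝ} (h : 1 < p) : informedSales z p z' p' = 0 := by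
  unfold informedSales
  have : informedDemand z p z' p' = fun _ => 0 := by
    funext t
    refine informedDemand_of_utility_neg ?_
    unfold utility
    linarith [abs_nonneg (t - z)]
  rw [this]
  simp

/-- Sales of the left firm when the market is shared at the indifferent consumer. -/
theorem informedSales_shared {x p y q : ℝ} (hx : 0 ≤ x) (hy : y ≤ 1)
    (h1 : p - q < y - x) (h2 : q - p < y - x) (h3 : p + x ≤ 1) (h4 : p + q + (y - x) ≤ 2) :
    informedSales x p y q = (q - p + x + y) / 2 := by
  -- The indifferent consumer; `h4` says precisely that this consumer's utility is nonnegative.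
  set s := (q - p + x + y) / 2 with hs
  have hxs : x < s := by linarith
  have hsy : s < y := by linarith
  unfold informedSales
  have : ∫ t in Set.Ioo (0 : ℝ) 1, informedDemand x p y q t
      = ∫ t in Set.Ioo (0 : ℝ) 1, (Set.Iio s).indicator (fun _ => (1 : ℝ)) t := by
    refine setIntegral_congr_ae measurableSet_Ioo ?_
    have hne : ∀ᵐ t : ℝ, t ≠ s := by
      simp [ae_iff, measure_singleton]
    filter_upwards [hne] with t hts ht
    rcases hts.lt_or_gt with h | h
    · rw [Set.indicator_of_mem (by exact h)]
      have e2 := abs_of_neg (show t - y < 0 by linarith)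
      apply informedDemand_eq_one <;> unfold utility <;>
        rcases abs_cases (t - x) with ⟨e, e'⟩ | ⟨e, e'⟩ <;> linarith [ht.1]
    · rw [Set.indicator_of_notMem (by simp [h.le])]
      have e2 := abs_of_pos (show 0 < t - x by linarith)
      apply informedDemand_eq_zero
      unfold utility
      rcases abs_cases (t - y) with ⟨e, e'⟩ | ⟨e, e'⟩ <;> linarith
  rw [this, setIntegral_indicator measurableSet_Iio, setIntegral_const]
  have : Set.Ioo (0 : ℝ) 1 ∩ Set.Iio s = Set.Ioo 0 s := by
    ext t
    simp only [Set.mem_inter_iff, Set.mem_Ioo, Set.mem_Iio]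
    constructor
    · exact fun h => ⟨h.1.1, h.2⟩
    · exact fun h => ⟨⟨h.1, by linarith [h.2]⟩, h.2⟩
  rw [this]
  simp [Measure.real, Real.volume_Ioo, ENNReal.toReal_ofReal (show 0 ≤ s by linarith)]

/-- Sales of the left firm when it undercuts its rival. -/
theorem informedSales_undercut {x p y q : ℝ} (hxy : x < y)
    (h1 : p + (y - x) < q) (h2 : p ≤ x) (h3 : p + x ≤ 1) :
    informedSales x p y q = 1 := by
  unfold informedSales
  have : ∫ t in Set.Ioo (0 : ℝ) 1, informedDemand x p y q t = ∫ t in Set.Ioo (0 : ℝ) 1, (1 : ℝ) := by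
    refine setIntegral_congr_fun measurableSet_Ioo ?_
    intro t ht
    apply informedDemand_eq_one <;> unfold utility <;>
      rcases abs_cases (t - x) with ⟨e, e'⟩ | ⟨e, e'⟩ <;>
      rcases abs_cases (t - y) with ⟨f, f'⟩ | ⟨f, f'⟩ <;> linarith [ht.1, ht.2]
  rw [this]
  simp

/-- Sales of the left firm when it is undercut by its rival. -/
theorem informedSales_undercut_by_rival {x p y q : ℝ} (hxy : x < y) (h1 : q + (y - x) < p) :
    informedSales x p y q = 0 := by
  unfold informedSales
  have : informedDemand x p y q = fun _ => 0 := by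
    funext t
    apply informedDemand_eq_zero
    unfold utility
    rcases abs_cases (t - x) with ⟨e, e'⟩ | ⟨e, e'⟩ <;>
      rcases abs_cases (t - y) with ⟨f, f'⟩ | ⟨f, f'⟩ <;> linarith
  rw [this]
  simp

/-- As an upper bound the sharing formula needs no participation conditions and survives the tie `p
= q + (y - x)`, where everybody left of `x` is indifferent. Both matter for deviations. -/
theorem informedSales_le_shared {x p y q : ℝ} (hx : 0 ≤ x)
    (h2 : q < p + (y - x)) (h1 : p ≤ q + (y - x)) :
    informedSales x p y q ≤ (q - p + x + y) / 2 := by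
  set s := (q - p + x + y) / 2 with hs
  have hxs : x ≤ s := by linarith
  have hsy : s < y := by linarith
  unfold informedSales
  have hle : ∫ t in Set.Ioo (0 : ℝ) 1, informedDemand x p y q t
      ≤ ∫ t in Set.Ioo (0 : ℝ) 1, (Set.Iic s).indicator (fun _ => (1 : ℝ)) t := by
    refine integral_mono (integrableOn_informedDemand ..)
      ((integrable_const (1 : ℝ)).indicator measurableSet_Iic) fun t => ?_
    by_cases h : t ≤ s
    · rw [Set.indicator_of_mem (by exact h)]
      exact informedDemand_le_one ..
    · rw [Set.indicator_of_notMem (by exact h)]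
      push Not at h
      have e2 := abs_of_pos (show 0 < t - x by linarith)
      apply le_of_eq
      apply informedDemand_eq_zero
      unfold utility
      rcases abs_cases (t - y) with ⟨e, e'⟩ | ⟨e, e'⟩ <;> linarith
  refine hle.trans ?_
  rw [setIntegral_indicator measurableSet_Iic, setIntegral_const]
  have : (volume.real (Set.Ioo (0 : ℝ) 1 ∩ Set.Iic s)) ≤ volume.real (Set.Ioc (0 : ℝ) s) := by
    refine measureReal_mono ?_ (by simp)
    intro t ht
    exact ⟨ht.1.1, ht.2⟩
  have h' : volume.real (Set.Ioc (0 : ℝ) s) = s := by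
    simp [Measure.real, Real.volume_Ioc, ENNReal.toReal_ofReal (show 0 ≤ s by linarith)]
  simpa using this.trans h'.le

theorem profit_shared {x p y q : ℝ} (hx : 0 ≤ x) (hy : y ≤ 1)
    (h1 : p - q < y - x) (h2 : q - p < y - x) (h3 : p + x ≤ 1) (h4 : p + q + (y - x) ≤ 2) :
    profit 0 x p y q = p * (1 + (q - p + x + y) / 2) := by
  rw [profit_eq, captiveDemand_zero_of_le hx h3, informedSales_shared hx hy h1 h2 h3 h4]

theorem profit_undercut {x p y q : ℝ} (hx : 0 ≤ x) (hxy : x < y)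
    (h1 : p + (y - x) < q) (h2 : p ≤ x) (h3 : p + x ≤ 1) : profit 0 x p y q = 2 * p := by
  rw [profit_eq, captiveDemand_zero_of_le hx h3, informedSales_undercut hxy h1 h2 h3]
  ring

theorem profit_undercut_by_rival {x p y q : ℝ} (hx : 0 ≤ x) (hxy : x < y)
    (h1 : q + (y - x) < p) (h3 : p + x ≤ 1) : profit 0 x p y q = p := by
  rw [profit_eq, captiveDemand_zero_of_le hx h3, informedSales_undercut_by_rival hxy h1]
  ring

theorem profit_le_shared {x p y q : ℝ} (hx : 0 ≤ x) (hp : 0 ≤ p)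
    (h2 : q < p + (y - x)) (h1 : p ≤ q + (y - x)) :
    profit 0 x p y q ≤ p * (1 + (q - p + x + y) / 2) := by
  rw [profit_eq]
  have := captiveDemand_le_one 0 x p
  have := informedSales_le_shared hx h2 h1
  gcongr

/-- Prices that lose the captive consumers are dominated by the highest price that keeps them. -/
theorem profit_le_profit_captive_price {x p y q : ℝ} (hx : 0 ≤ x) (hx' : x ≤ 1 / 2)
    (hp : 1 - x ≤ p) : profit 0 x p y q ≤ profit 0 x (1 - x) y q := by
  rcases hp.eq_or_lt with rfl | hp
  · exact le_rfl
  rw [profit_eq, profit_eq, captiveDemand_zero_of_lt hx (by linarith),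
    captiveDemand_zero_of_le hx (by linarith)]
  have h0 := informedSales_nonneg x (1 - x) y q
  have h1 := informedSales_le_one x (1 - x) y q
  rcases le_or_gt p 1 with hp1 | hp1
  · have := informedSales_antitone (z := x) (z' := y) (p' := q) hp.le
    nlinarith [informedSales_nonneg x p y q]
  · rw [informedSales_of_one_lt hp1]
    nlinarith

/-- The mirror image `t ↦ 1 - t` of the line lets the lemmas on the left firm serve for Firm 2. -/
theorem profit_reflect (c z p z' p' : ℝ) :
    profit (1 - c) z p z' p' = profit c (1 - z) p (1 - z') p' := by
  have hu : ∀ z p t : ℝ, utility z p (1 - t) = utility (1 - z) p t := fun z p t => by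
    unfold utility
    rw [abs_sub_comm]
    ring_nf
  have hi : ∀ t, informedDemand z p z' p' (1 - t) = informedDemand (1 - z) p (1 - z') p' t := by
    intro t
    simp only [informedDemand, hu]
  unfold profit
  congr 2
  · simp only [captiveDemand, hu]
  · rw [← integral_Ioc_eq_integral_Ioo, ← integral_Ioc_eq_integral_Ioo,
      ← intervalIntegral.integral_of_le zero_le_one, ← intervalIntegral.integral_of_le zero_le_one]
    simp_rw [← hi]
    rw [intervalIntegral.integral_comp_sub_left (fun t => informedDemand z p z' p' t)]
    norm_num

end CaptiveHotelling

namespace CaptiveHotelling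

/-! ### Distributions with a density and one atom -/

/-- The measure with density `f` on `(a, b]` and an atom of mass `c` at `d`. -/
def densityWithAtom (f : ℝ → ℝ) (a b c d : ℝ) : Measure ℝ :=
  (volume.restrict (Set.Ioc a b)).withDensity (fun x => ENNReal.ofReal (f x))
    + ENNReal.ofReal c • Measure.dirac d

variable {f : ℝ → ℝ} {a b c d : ℝ}

theorem integrableOn_Ioc_of_continuousOn (hf : ContinuousOn f (Set.Icc a b)) :
    IntegrableOn f (Set.Ioc a b) :=
  (hf.integrableOn_compact isCompact_Icc).mono_set Set.Ioc_subset_Icc_self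

theorem isFiniteMeasure_densityWithAtom (hf : ContinuousOn f (Set.Icc a b)) :
    IsFiniteMeasure (densityWithAtom f a b c d) := by
  have := isFiniteMeasure_withDensity_ofReal (integrableOn_Ioc_of_continuousOn hf).2
  have : IsFiniteMeasure (ENNReal.ofReal c • Measure.dirac d : Measure ℝ) :=
    Measure.smul_finite _ ENNReal.ofReal_ne_top
  unfold densityWithAtom
  infer_instance

/-- End points are null unless they carry the atom, and an atom of mass zero imposes nothing. Ties
occur only at such prices. -/
theorem ae_densityWithAtom {P : ℝ → Prop} (h : ∀ x ∈ Set.Ioo a b, P x)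
    (hd : c = 0 ∨ P d) : ∀ᵐ x ∂densityWithAtom f a b c d, P x := by
  unfold densityWithAtom
  rw [ae_add_measure_iff]
  constructor
  · refine (withDensity_absolutelyContinuous _ _).ae_le ?_
    rw [← restrict_Ioo_eq_restrict_Ioc]
    filter_upwards [ae_restrict_mem measurableSet_Ioo] with x hx using h x hx
  · rcases hd with rfl | hd
    · simp
    · refine (Measure.smul_absolutelyContinuous).ae_le ?_
      rw [ae_dirac_eq]
      exact hd

theorem integrable_of_bounded {μ : Measure ℝ} [IsFiniteMeasure μ] {φ : ℝ → ℝ} (hφ : Measurable φ)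
    {M : ℝ} (hM : ∀ x, |φ x| ≤ M) : Integrable φ μ :=
  Integrable.of_bound hφ.aestronglyMeasurable M (Eventually.of_forall hM)

theorem integral_densityWithAtom (hab : a ≤ b) (hf : ContinuousOn f (Set.Icc a b))
    (hf0 : ∀ x ∈ Set.Icc a b, 0 ≤ f x) (hc : 0 ≤ c) {φ : ℝ → ℝ} (hφ : Measurable φ)
    {M : ℝ} (hM : ∀ x, |φ x| ≤ M) :
    ∫ x, φ x ∂densityWithAtom f a b c d = (∫ x in a..b, φ x * f x) + c * φ d := by
  have h1 := isFiniteMeasure_withDensity_ofReal (integrableOn_Ioc_of_continuousOn hf).2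
  have h2 : IsFiniteMeasure (ENNReal.ofReal c • Measure.dirac d : Measure ℝ) :=
    Measure.smul_finite _ ENNReal.ofReal_ne_top
  unfold densityWithAtom
  rw [integral_add_measure (integrable_of_bounded hφ hM) (integrable_of_bounded hφ hM),
    integral_smul_measure, integral_dirac, ENNReal.toReal_ofReal hc, smul_eq_mul,
    integral_withDensity_eq_integral_toReal_smul₀
      (integrableOn_Ioc_of_continuousOn hf).1.aemeasurable.ennreal_ofReal
      (Eventually.of_forall fun _ => ENNReal.ofReal_lt_top),
    intervalIntegral.integral_of_le hab]
  congr 1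
  refine setIntegral_congr_fun measurableSet_Ioc fun x hx => ?_
  rw [ENNReal.toReal_ofReal (hf0 x ⟨hx.1.le, hx.2⟩), smul_eq_mul, mul_comm]

theorem intervalIntegrable_mul_density (hf : ContinuousOn f (Set.Icc a b)) {φ : ℝ → ℝ}
    (hφ : Measurable φ) {M : ℝ} (hM : ∀ x, |φ x| ≤ M) {x y : ℝ} (hx : a ≤ x) (hxy : x ≤ y)
    (hy : y ≤ b) : IntervalIntegrable (fun x => φ x * f x) volume x y := by
  rw [intervalIntegrable_iff_integrableOn_Ioc_of_le hxy]
  exact (integrableOn_Ioc_of_continuousOn (hf.mono (Set.Icc_subset_Icc hx hy))).bdd_mul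
    hφ.aestronglyMeasurable (Eventually.of_forall hM)

variable {F : ℝ → ℝ}

theorem integral_eq_sub_of_hasDerivAt_Icc (hF : ∀ x ∈ Set.Icc a b, HasDerivAt F (f x) x)
    (hf : ContinuousOn f (Set.Icc a b)) {x y : ℝ} (hx : a ≤ x) (hxy : x ≤ y) (hy : y ≤ b) :
    ∫ t in x..y, f t = F y - F x := by
  have hs : Set.Icc x y ⊆ Set.Icc a b := Set.Icc_subset_Icc hx hy
  apply intervalIntegral.integral_eq_sub_of_hasDerivAt
  · rw [Set.uIcc_of_le hxy]
    exact fun t ht => hF t (hs ht)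
  · apply ContinuousOn.intervalIntegrable
    rw [Set.uIcc_of_le hxy]
    exact hf.mono hs

theorem isProbabilityMeasure_densityWithAtom (hab : a ≤ b) (hf : ContinuousOn f (Set.Icc a b))
    (hf0 : ∀ x ∈ Set.Icc a b, 0 ≤ f x) (hF : ∀ x ∈ Set.Icc a b, HasDerivAt F (f x) x)
    (hFa : F a = 0) (hFb : F b ≤ 1) : IsProbabilityMeasure (densityWithAtom f a b (1 - F b) d) := by
  have := isFiniteMeasure_densityWithAtom (c := 1 - F b) (d := d) hf
  have h := integral_densityWithAtom (c := 1 - F b) (d := d) hab hf hf0 (by linarith)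
    (φ := fun _ => 1) measurable_const (M := 1) (by simp)
  simp only [one_mul, mul_one, integral_eq_sub_of_hasDerivAt_Icc hF hf le_rfl hab le_rfl, hFa,
    integral_const, smul_eq_mul] at h
  refine ⟨?_⟩
  rw [← ENNReal.toReal_eq_one_iff, ← Measure.real, h]
  ring

theorem cdf_densityWithAtom (hab : a ≤ b) (hbd : b ≤ d) (hf : ContinuousOn f (Set.Icc a b))
    (hf0 : ∀ x ∈ Set.Icc a b, 0 ≤ f x) (hF : ∀ x ∈ Set.Icc a b, HasDerivAt F (f x) x)
    (hFa : F a = 0) (hFb : F b ≤ 1) (p : ℝ) :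
    ProbabilityTheory.cdf (densityWithAtom f a b (1 - F b) d) p
      = if p < a then 0 else if p < b then F p else if p < d then F b else 1 := by
  have := isProbabilityMeasure_densityWithAtom (d := d) hab hf hf0 hF hFa hFb
  rw [ProbabilityTheory.cdf_eq_real, ← integral_indicator_one measurableSet_Iic]
  rw [integral_densityWithAtom hab hf hf0 (by linarith)
      (measurable_one.indicator measurableSet_Iic) (M := 1)]
  · have hm : Measurable ((Set.Iic p).indicator (1 : ℝ → ℝ)) :=
      measurable_one.indicator measurableSet_Iic
    have hb : ∀ x, |(Set.Iic p).indicator (1 : ℝ → ℝ) x| ≤ 1 := fun x => by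
      by_cases hx : x ∈ Set.Iic p <;> simp [hx]
    have hle : ∀ x y, a ≤ x → x ≤ y → y ≤ b → y ≤ p →
        ∫ t in x..y, (Set.Iic p).indicator (1 : ℝ → ℝ) t * f t = F y - F x := by
      intro x y hx hxy hy hp
      rw [← integral_eq_sub_of_hasDerivAt_Icc hF hf hx hxy hy]
      refine intervalIntegral.integral_congr_Ioo_of_le hxy fun t ht => ?_
      have : t ∈ Set.Iic p := ht.2.le.trans hp
      simp [this]
    have hgt : ∀ x y, x ≤ y → p ≤ x →
        ∫ t in x..y, (Set.Iic p).indicator (1 : ℝ → ℝ) t * f t = 0 := by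
      intro x y hxy hp
      rw [← intervalIntegral.integral_zero (a := x) (b := y)]
      refine intervalIntegral.integral_congr_Ioo_of_le hxy fun t ht => ?_
      have : t ∉ Set.Iic p := fun h => absurd (lt_of_le_of_lt hp ht.1) (not_lt.2 h)
      simp [this]
    split_ifs with h1 h2 h3
    · rw [hgt a b hab h1.le, Set.indicator_of_notMem (by simp; linarith)]
      simp
    · push Not at h1
      rw [← intervalIntegral.integral_add_adjacent_intervals (intervalIntegrable_mul_density hf hm hb le_rfl h1 h2.le)
        (intervalIntegrable_mul_density hf hm hb h1 h2.le le_rfl), hle a p le_rfl h1 h2.le le_rfl, hgt p b h2.le le_rfl, hFa,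
        Set.indicator_of_notMem (by simp; linarith)]
      ring
    · push Not at h2
      rw [hle a b le_rfl hab le_rfl h2, hFa, Set.indicator_of_notMem (by simp; linarith)]
      ring
    · push Not at h2 h3
      rw [hle a b le_rfl hab le_rfl h2, hFa, Set.indicator_of_mem (by simpa using h3)]
      simp
  · intro x
    by_cases hx : x ∈ Set.Iic p <;> simp [hx]

end CaptiveHotelling

namespace CaptiveHotelling

/-! ### The equilibrium conditions -/

/-- The properties of the distribution functions `G` of Firm 1 and `H` of Firm 2 on the intervals
of prices that make them the continuous parts of equilibrium strategies. -/
structure EquilibriumData (z₁ z₂ w π : ℝ) (G H : ℝ → ℝ) : Prop where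
  lt_z₁ : 3 / 7 < z₁
  z₁_le : z₁ ≤ 1 / 2
  z₁_lt_z₂ : z₁ < z₂
  z₂_lt : z₂ < 1
  sub_le : z₂ - z₁ ≤ 1 / 2
  one_le_add : 1 ≤ z₁ + z₂
  w_pos : 0 < w
  w_le : w ≤ 3 * z₁ / 4
  w_le' : w ≤ 2 * z₂ - 1
  hasDerivAt_G : ∀ p ∈ Set.Icc (z₁ - w) z₁,
    HasDerivAt G (lam z₂ * (G p - 1) + 2 * lam z₂ * π / (p + (z₂ - z₁)) ^ 2) p
  G_left : G (z₁ - w) = 0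
  G_right_le : G z₁ ≤ 1
  G_density_nonneg : ∀ p ∈ Set.Icc (z₁ - w) z₁,
    0 ≤ lam z₂ * (G p - 1) + 2 * lam z₂ * π / (p + (z₂ - z₁)) ^ 2
  -- Firm 2's payoff at its top price `z₂`: its captives always buy, and informed consumers are
  -- gained only against the atom at `1 - z₁`.
  π_eq : π = z₂ * (1 + (1 - G z₁) * (3 - 2 * z₁ - 2 * z₂) / 2)
  -- The left side is the limit of Firm 2's profit as its price rises to `1 - z₂`: the atom is
  -- undercut, the market is shared otherwise.
  deviation : (1 - z₂) * (z₂ - 1 / 2 - w / 2 + (1 - G z₁) * z₁ + π / (z₂ - w)) ≤ π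
  hasDerivAt_H : ∀ p ∈ Set.Icc (z₂ - w) z₂,
    HasDerivAt H (4 * lam z₂ * (z₁ - w) / (p - (z₂ - z₁)) ^ 2 - lam z₂ * H p) p
  H_left : H (z₂ - w) = 0
  H_right_le : H z₂ ≤ 1
  H_density_nonneg : ∀ p ∈ Set.Icc (z₂ - w) z₂,
    0 ≤ 4 * lam z₂ * (z₁ - w) / (p - (z₂ - z₁)) ^ 2 - lam z₂ * H p
  -- Firm 1's indifference between `1 - z₁` and its interval, divided by `1 - z₁`.
  H_right : (1 - z₂) * H z₂ + z₁ + z₂ + 1 / 2 - 2 * w / z₁ = 2 * (z₁ - w) / (1 - z₁)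

namespace EquilibriumData

/-- The price distribution of Firm 1. -/
def strategy₁ (z₁ z₂ w π : ℝ) (G : ℝ → ℝ) : Measure ℝ :=
  densityWithAtom (fun p => lam z₂ * (G p - 1) + 2 * lam z₂ * π / (p + (z₂ - z₁)) ^ 2)
    (z₁ - w) z₁ (1 - G z₁) (1 - z₁)

/-- The price distribution of Firm 2. -/
def strategy₂ (z₁ z₂ w : ℝ) (H : ℝ → ℝ) : Measure ℝ :=
  densityWithAtom (fun p => 4 * lam z₂ * (z₁ - w) / (p - (z₂ - z₁)) ^ 2 - lam z₂ * H p)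
    (z₂ - w) z₂ (1 - H z₂) z₂

variable {z₁ z₂ w π : ℝ} {G H : ℝ → ℝ}

theorem lam_pos (E : EquilibriumData z₁ z₂ w π G H) : 0 < lam z₂ := by
  have := E.z₂_lt
  unfold lam
  exact one_div_pos.2 (by linarith)

theorem one_sub_eq (E : EquilibriumData z₁ z₂ w π G H) : (1 - z₂) * (2 * lam z₂) = 1 := by
  have : 1 - z₂ ≠ 0 := by linarith [E.z₂_lt]
  unfold lam
  field_simp

theorem continuousOn_G_density (E : EquilibriumData z₁ z₂ w π G H) : ContinuousOn
    (fun p => lam z₂ * (G p - 1) + 2 * lam z₂ * π / (p + (z₂ - z₁)) ^ 2)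
    (Set.Icc (z₁ - w) z₁) := by
  have hG : ContinuousOn G (Set.Icc (z₁ - w) z₁) :=
    fun p hp => (E.hasDerivAt_G p hp).continuousAt.continuousWithinAt
  refine ContinuousOn.add (continuousOn_const.mul (hG.sub continuousOn_const))
    (continuousOn_const.div (by fun_prop) ?_)
  intro p hp
  have : 0 < p + (z₂ - z₁) := by linarith [hp.1, E.z₁_lt_z₂, E.w_le, E.lt_z₁]
  positivity

theorem continuousOn_H_density (E : EquilibriumData z₁ z₂ w π G H) : ContinuousOn
    (fun p => 4 * lam z₂ * (z₁ - w) / (p - (z₂ - z₁)) ^ 2 - lam z₂ * H p)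
    (Set.Icc (z₂ - w) z₂) := by
  have hH : ContinuousOn H (Set.Icc (z₂ - w) z₂) :=
    fun p hp => (E.hasDerivAt_H p hp).continuousAt.continuousWithinAt
  refine ContinuousOn.sub (continuousOn_const.div (by fun_prop) ?_) (continuousOn_const.mul hH)
  intro p hp
  have : 0 < p - (z₂ - z₁) := by linarith [hp.1, E.w_le, E.lt_z₁]
  positivity

/-- Integration by parts leaves `∫ H`, which is elementary because the differential equation
expresses `H` through `H'` and an inverse square. -/
theorem integral_affine_mul_H_density (E : EquilibriumData z₁ z₂ w π G H)
    (A B : ℝ) {x y : ℝ} (hx : z₂ - w ≤ x) (hxy : x ≤ y)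
    (hy : y ≤ z₂) :
    ∫ s in x..y, (A + B * s) * (4 * lam z₂ * (z₁ - w) / (s - (z₂ - z₁)) ^ 2 - lam z₂ * H s)
      = ((A + B * y) * H y + B * (2 * (1 - z₂) * H y + 4 * (z₁ - w) / (y - (z₂ - z₁))))
        - ((A + B * x) * H x + B * (2 * (1 - z₂) * H x + 4 * (z₁ - w) / (x - (z₂ - z₁)))) := by
  refine integral_eq_sub_of_hasDerivAt_Icc (a := z₂ - w) (b := z₂)
    (f := fun s => (A + B * s) * (4 * lam z₂ * (z₁ - w) / (s - (z₂ - z₁)) ^ 2 - lam z₂ * H s))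
    (F := fun s => (A + B * s) * H s + B * (2 * (1 - z₂) * H s + 4 * (z₁ - w) / (s - (z₂ - z₁))))
    ?_ ((by fun_prop : ContinuousOn (fun s => A + B * s) _).mul E.continuousOn_H_density)
    hx hxy hy
  intro s hs
  have hq : s - (z₂ - z₁) ≠ 0 := by linarith [hs.1, E.w_le, E.lt_z₁]
  have d0 : HasDerivAt (fun s : ℝ => A + B * s) (B * 1) s :=
    ((hasDerivAt_id s).const_mul B).const_add A
  have d1 := ((hasDerivAt_id s).sub_const (z₂ - z₁)).fun_inv hq
  have dH := E.hasDerivAt_H s hs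
  refine (((d0.mul dH).add (((dH.const_mul (2 * (1 - z₂))).add
    (d1.const_mul (4 * (z₁ - w)))).const_mul B)).congr_of_eventuallyEq
    (Eventually.of_forall fun x => ?_)).congr_deriv ?_
  · simp [div_eq_mul_inv]
  · have := E.one_sub_eq
    simp only [id]
    linear_combination (-(B * H s - 4 * B * (z₁ - w) / (s - (z₂ - z₁)) ^ 2)) * this

theorem integral_affine_mul_G_density (E : EquilibriumData z₁ z₂ w π G H)
    (A B : ℝ) {x y : ℝ} (hx : z₁ - w ≤ x) (hxy : x ≤ y)
    (hy : y ≤ z₁) :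
    ∫ s in x..y, (A + B * s) * (lam z₂ * (G s - 1) + 2 * lam z₂ * π / (s + (z₂ - z₁)) ^ 2)
      = ((A + B * y) * G y - B * (2 * (1 - z₂) * G y + 2 * π / (y + (z₂ - z₁)) + y))
        - ((A + B * x) * G x - B * (2 * (1 - z₂) * G x + 2 * π / (x + (z₂ - z₁)) + x)) := by
  refine integral_eq_sub_of_hasDerivAt_Icc (a := z₁ - w) (b := z₁)
    (f := fun s => (A + B * s)
      * (lam z₂ * (G s - 1) + 2 * lam z₂ * π / (s + (z₂ - z₁)) ^ 2))
    (F := fun s => (A + B * s) * G s - B * (2 * (1 - z₂) * G s + 2 * π / (s + (z₂ - z₁)) + s))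
    ?_ ((by fun_prop : ContinuousOn (fun s => A + B * s) _).mul E.continuousOn_G_density)
    hx hxy hy
  intro s hs
  have hq : s + (z₂ - z₁) ≠ 0 := by linarith [hs.1, E.w_le, E.lt_z₁, E.z₁_lt_z₂]
  have d0 : HasDerivAt (fun s : ℝ => A + B * s) (B * 1) s :=
    ((hasDerivAt_id s).const_mul B).const_add A
  have d1 := ((hasDerivAt_id s).add_const (z₂ - z₁)).fun_inv hq
  have dG := E.hasDerivAt_G s hs
  refine (((d0.mul dG).sub ((((dG.const_mul (2 * (1 - z₂))).add
    (d1.const_mul (2 * π))).add (hasDerivAt_id s)).const_mul B)).congr_of_eventuallyEq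
    (Eventually.of_forall fun x => ?_)).congr_deriv ?_
  · simp [div_eq_mul_inv]
  · have := E.one_sub_eq
    simp only [id]
    linear_combination (-(B * (G s - 1) + 2 * B * π / (s + (z₂ - z₁)) ^ 2)) * this

theorem isProbabilityMeasure₁ (E : EquilibriumData z₁ z₂ w π G H)
    : IsProbabilityMeasure (strategy₁ z₁ z₂ w π G) :=
  isProbabilityMeasure_densityWithAtom (by linarith [E.w_pos]) E.continuousOn_G_density
    E.G_density_nonneg E.hasDerivAt_G E.G_left E.G_right_le

theorem isProbabilityMeasure₂ (E : EquilibriumData z₁ z₂ w π G H)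
    : IsProbabilityMeasure (strategy₂ z₁ z₂ w H) :=
  isProbabilityMeasure_densityWithAtom (by linarith [E.w_pos]) E.continuousOn_H_density
    E.H_density_nonneg E.hasDerivAt_H E.H_left E.H_right_le

theorem cdf_strategy₁ (E : EquilibriumData z₁ z₂ w π G H)
    (p : ℝ) : ProbabilityTheory.cdf (strategy₁ z₁ z₂ w π G) p
    = if p < z₁ - w then 0 else if p < z₁ then G p else if p < 1 - z₁ then G z₁ else 1 :=
  cdf_densityWithAtom (by linarith [E.w_pos]) (by linarith [E.z₁_le]) E.continuousOn_G_density
    E.G_density_nonneg E.hasDerivAt_G E.G_left E.G_right_le p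

theorem cdf_strategy₂ (E : EquilibriumData z₁ z₂ w π G H)
    (p : ℝ) : ProbabilityTheory.cdf (strategy₂ z₁ z₂ w H) p
    = if p < z₂ - w then 0 else if p < z₂ then H p else 1 := by
  refine (cdf_densityWithAtom (by linarith [E.w_pos]) le_rfl E.continuousOn_H_density
    E.H_density_nonneg E.hasDerivAt_H E.H_left E.H_right_le p).trans ?_
  split_ifs <;> rfl

end EquilibriumData

end CaptiveHotelling

namespace CaptiveHotelling

/-! ### Crude bounds on expected profits -/

theorem measurable_profit_right (c z p z' : ℝ) : Measurable fun p' => profit c z p z' p' :=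
  (measurable_profit c z z').comp (by fun_prop : Measurable fun p' : ℝ => (p, p'))

theorem integrable_profit {μ : Measure ℝ} [IsFiniteMeasure μ] (c z p z' : ℝ) :
    Integrable (fun p' => profit c z p z' p') μ :=
  integrable_of_bounded (measurable_profit_right c z p z') fun _ => abs_profit_le ..

theorem integral_profit_le_two_mul {μ : Measure ℝ} [IsProbabilityMeasure μ] {c z p z' : ℝ}
    (hp : 0 ≤ p) : ∫ p', profit c z p z' p' ∂μ ≤ 2 * p := by
  calc _ ≤ ∫ _, 2 * p ∂μ :=
        integral_mono (integrable_profit ..) (integrable_const _) fun _ => profit_le_two_mul hp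
    _ = 2 * p := by simp

theorem integral_profit_nonpos {μ : Measure ℝ} {c z p z' : ℝ}
    (hp : p ≤ 0) : ∫ p', profit c z p z' p' ∂μ ≤ 0 :=
  integral_nonpos fun _ => profit_nonpos hp

namespace EquilibriumData

/-! ### Firm 1 -/

variable {z₁ z₂ w π : ℝ} {G H : ℝ → ℝ}

theorem expectedProfit₁_eq (E : EquilibriumData z₁ z₂ w π G H) (p : ℝ) :
    expectedProfit₁ z₁ z₂ (strategy₂ z₁ z₂ w H) p
      = (∫ s in (z₂ - w)..z₂, profit 0 z₁ p z₂ s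
          * (4 * lam z₂ * (z₁ - w) / (s - (z₂ - z₁)) ^ 2 - lam z₂ * H s))
        + (1 - H z₂) * profit 0 z₁ p z₂ z₂ :=
  integral_densityWithAtom (by linarith [E.w_pos]) E.continuousOn_H_density E.H_density_nonneg
    (by linarith [E.H_right_le]) (measurable_profit_right ..) fun _ => abs_profit_le ..

theorem expectedProfit₁_mono (E : EquilibriumData z₁ z₂ w π G H) {p q : ℝ}
    (h : ∀ s ∈ Set.Ioc (z₂ - w) z₂, profit 0 z₁ p z₂ s ≤ profit 0 z₁ q z₂ s) :
    expectedProfit₁ z₁ z₂ (strategy₂ z₁ z₂ w H) p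
      ≤ expectedProfit₁ z₁ z₂ (strategy₂ z₁ z₂ w H) q := by
  have := E.isProbabilityMeasure₂
  refine integral_mono_ae (integrable_profit ..) (integrable_profit ..) ?_
  exact ae_densityWithAtom (fun s hs => h s ⟨hs.1, hs.2.le⟩)
    (Or.inr (h z₂ ⟨by linarith [E.w_pos], le_rfl⟩))

theorem profit₁_shared (E : EquilibriumData z₁ z₂ w π G H) {p s : ℝ}
    (hp' : p ≤ 1 - z₁) (hs : z₂ - w < s) (hs' : s ≤ z₂) (h : s < p + (z₂ - z₁)) :
    profit 0 z₁ p z₂ s = p * (1 + (s - p + z₁ + z₂) / 2) := by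
  have := E.lt_z₁
  have := E.z₁_le
  have := E.z₁_lt_z₂
  have := E.z₂_lt
  have := E.w_le'
  have := E.w_pos
  apply profit_shared <;> linarith [E.w_le, E.one_le_add, E.sub_le]

theorem profit₁_undercut (E : EquilibriumData z₁ z₂ w π G H) {p s : ℝ}
    (hp' : p ≤ z₁) (h : p + (z₂ - z₁) < s) : profit 0 z₁ p z₂ s = 2 * p := by
  have := E.lt_z₁
  have := E.z₁_le
  have := E.z₁_lt_z₂
  apply profit_undercut <;> linarith

/-- Splitting at `s = p + δ` separates sharing from undercutting, and the closed integrals cancel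
the dependence on `p`. The correction concerns Firm 2's atom and vanishes for `p < z₁`, where the
atom is undercut. -/
theorem expectedProfit₁_support (E : EquilibriumData z₁ z₂ w π G H) {p : ℝ} (hp : z₁ - w ≤ p)
    (hp' : p ≤ z₁) : expectedProfit₁ z₁ z₂ (strategy₂ z₁ z₂ w H) p
      = 2 * (z₁ - w) - (1 - H z₂) * (2 * p - profit 0 z₁ p z₂ z₂) := by
  have h0 : 0 < p := by linarith [E.w_le, E.lt_z₁]
  have hw := E.w_pos
  have h1 : z₂ - w ≤ p + (z₂ - z₁) := by linarith
  have h2 : p + (z₂ - z₁) ≤ z₂ := by linarith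
  have hm := measurable_profit_right 0 z₁ p z₂
  have hb : ∀ s, |profit 0 z₁ p z₂ s| ≤ 2 * |p| := fun s => abs_profit_le ..
  rw [E.expectedProfit₁_eq, ← intervalIntegral.integral_add_adjacent_intervals
    (intervalIntegrable_mul_density E.continuousOn_H_density hm hb le_rfl h1 h2)
    (intervalIntegrable_mul_density E.continuousOn_H_density hm hb h1 h2 le_rfl),
    intervalIntegral.integral_congr_Ioo_of_le h1 (g := fun s =>
      (p * (1 + (z₁ + z₂ - p) / 2) + p / 2 * s)
        * (4 * lam z₂ * (z₁ - w) / (s - (z₂ - z₁)) ^ 2 - lam z₂ * H s)),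
    intervalIntegral.integral_congr_Ioo_of_le h2 (g := fun s =>
      (2 * p + 0 * s) * (4 * lam z₂ * (z₁ - w) / (s - (z₂ - z₁)) ^ 2 - lam z₂ * H s)),
    E.integral_affine_mul_H_density _ _ le_rfl h1 h2,
    E.integral_affine_mul_H_density _ _ h1 h2 le_rfl, E.H_left]
  · have e1 : p + (z₂ - z₁) - (z₂ - z₁) = p := by ring
    have e2 : z₂ - w - (z₂ - z₁) = z₁ - w := by ring
    have h3 : z₁ - w ≠ 0 := by linarith [E.w_le, E.lt_z₁]
    rw [e1, e2]
    field_simp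
    ring
  · intro s hs
    simp only
    rw [E.profit₁_undercut hp' hs.1]
    ring
  · intro s hs
    simp only
    rw [E.profit₁_shared (by linarith [E.z₁_le]) hs.1 (by linarith [hs.2]) hs.2]
    ring

theorem expectedProfit₁_top (E : EquilibriumData z₁ z₂ w π G H) :
    expectedProfit₁ z₁ z₂ (strategy₂ z₁ z₂ w H) (1 - z₁) = 2 * (z₁ - w) := by
  have hw := E.w_pos
  have h1 : z₂ - w ≤ z₂ := by linarith
  have hz := E.z₁_le
  have hz' := E.lt_z₁
  have h5 : 1 - z₁ ≠ 0 := by linarith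
  have h := E.H_right
  rw [eq_div_iff h5] at h
  -- If `z₁ = 1 / 2`, the prices `1 - z₁` and `z₂` tie and the sharing formula is unavailable, but
  -- then `H_right` forces `H z₂ = 1` and Firm 2 has no atom.
  have hatom : (1 - H z₂) * profit 0 z₁ (1 - z₁) z₂ z₂
      = (1 - H z₂) * ((1 - z₁) * (1 + (z₂ - (1 - z₁) + z₁ + z₂) / 2)) := by
    rcases hz.eq_or_lt with rfl | hz
    · have : 1 - z₂ ≠ 0 := by linarith [E.z₂_lt]
      have : 1 - H z₂ = 0 := by
        apply mul_left_cancel₀ this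
        linarith
      rw [this, zero_mul, zero_mul]
    · rw [E.profit₁_shared le_rfl (by linarith) le_rfl (by linarith)]
  rw [E.expectedProfit₁_eq, hatom,
    intervalIntegral.integral_congr_Ioo_of_le h1 (g := fun s =>
      ((1 - z₁) * (1 + (z₁ + z₂ - (1 - z₁)) / 2) + (1 - z₁) / 2 * s)
        * (4 * lam z₂ * (z₁ - w) / (s - (z₂ - z₁)) ^ 2 - lam z₂ * H s)),
    E.integral_affine_mul_H_density _ _ le_rfl h1 le_rfl, E.H_left]
  · have e1 : z₂ - (z₂ - z₁) = z₁ := by ring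
    have e2 : z₂ - w - (z₂ - z₁) = z₁ - w := by ring
    have h3 : z₁ - w ≠ 0 := by linarith [E.w_le, E.lt_z₁]
    have h4 : z₁ ≠ 0 := by linarith
    rw [e1, e2, mul_div_assoc 4 (z₁ - w) (z₁ - w), div_self h3]
    have h6 : 4 * (z₁ - w) / z₁ = 4 - 2 * (2 * w / z₁) := by field_simp; ring
    rw [h6]
    linear_combination h
  · intro s hs
    simp only
    rw [E.profit₁_shared le_rfl hs.1 hs.2.le
      (by linarith [E.z₂_lt, E.z₁_lt_z₂, hs.2])]
    ring

/-- Below the interval even the whole market pays too little. From `z₁` to `1 - z₁` the market is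
shared with every rival price and profit rises with `p`; beyond that the captives are lost. -/
theorem expectedProfit₁_le (E : EquilibriumData z₁ z₂ w π G H) (p : ℝ) :
    expectedProfit₁ z₁ z₂ (strategy₂ z₁ z₂ w H) p ≤ 2 * (z₁ - w) := by
  have hp := E.isProbabilityMeasure₂
  have hw := E.w_pos
  have hz := E.z₁_le
  have hz' := E.lt_z₁
  have hα : 0 < z₁ - w := by linarith [E.w_le]
  rcases le_total p 0 with h0 | h0
  · exact (integral_profit_nonpos h0).trans (by linarith)
  rcases le_total p (z₁ - w) with h1 | h1
  · exact (integral_profit_le_two_mul h0).trans (by linarith)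
  rcases le_or_gt p z₁ with h2 | h2
  · rw [E.expectedProfit₁_support h1 h2]
    have := profit_le_two_mul (c := 0) (z := z₁) (z' := z₂) (p' := z₂) h0
    nlinarith [E.H_right_le]
  rw [← E.expectedProfit₁_top]
  rcases le_total p (1 - z₁) with h3 | h3
  · refine E.expectedProfit₁_mono fun s hs => ?_
    rw [E.profit₁_shared h3 hs.1 hs.2 (by linarith [hs.2]),
      E.profit₁_shared le_rfl hs.1 hs.2 (by linarith [hs.2])]
    have : 0 ≤ (1 - z₁ - p) * (1 + (s - 1 - (p - z₁) + z₁ + z₂) / 2) :=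
      mul_nonneg (by linarith) (by linarith [hs.1, E.one_le_add])
    nlinarith
  · exact E.expectedProfit₁_mono fun s _ => profit_le_profit_captive_price (by linarith) hz h3

theorem ae_expectedProfit₁ (E : EquilibriumData z₁ z₂ w π G H) :
    ∀ᵐ p ∂strategy₁ z₁ z₂ w π G,
      expectedProfit₁ z₁ z₂ (strategy₂ z₁ z₂ w H) p = 2 * (z₁ - w) := by
  refine ae_densityWithAtom (fun p hp => ?_) (Or.inr E.expectedProfit₁_top)
  rw [E.expectedProfit₁_support hp.1.le hp.2.le, E.profit₁_undercut hp.2.le (by linarith [hp.2])]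
  ring

end EquilibriumData

end CaptiveHotelling

namespace CaptiveHotelling

namespace EquilibriumData

/-! ### Firm 2 -/

variable {z₁ z₂ w π : ℝ} {G H : ℝ → ℝ}

theorem profit₂_reflect (z₁ z₂ p s : ℝ) :
    profit 1 z₂ p z₁ s = profit 0 (1 - z₂) p (1 - z₁) s := by
  simpa using profit_reflect 0 z₂ p z₁ s

theorem half_lt_z₂ (E : EquilibriumData z₁ z₂ w π G H) : 1 / 2 < z₂ := by
  linarith [E.w_pos, E.w_le']

theorem profit₂_shared (E : EquilibriumData z₁ z₂ w π G H) {p s : ℝ} (hp : p ≤ z₂)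
    (hs : s ≤ 1 - z₁) (h1 : p < s + (z₂ - z₁)) (h2 : s < p + (z₂ - z₁)) :
    profit 1 z₂ p z₁ s = p * (2 - (p - s + z₁ + z₂) / 2) := by
  rw [profit₂_reflect, profit_shared] <;> linarith [E.z₂_lt, E.sub_le, E.lt_z₁]

theorem profit₂_undercut_by_rival (E : EquilibriumData z₁ z₂ w π G H) {p s : ℝ} (hp : p ≤ z₂)
    (h1 : s + (z₂ - z₁) < p) : profit 1 z₂ p z₁ s = p := by
  rw [profit₂_reflect, profit_undercut_by_rival] <;> linarith [E.z₂_lt, E.z₁_lt_z₂]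

theorem profit₂_le_shared (E : EquilibriumData z₁ z₂ w π G H) {p s : ℝ} (hp : 0 ≤ p)
    (h1 : p ≤ s + (z₂ - z₁)) (h2 : s < p + (z₂ - z₁)) :
    profit 1 z₂ p z₁ s ≤ p * (2 - (p - s + z₁ + z₂) / 2) := by
  rw [profit₂_reflect]
  refine (profit_le_shared (by linarith [E.z₂_lt]) hp (by linarith) (by linarith)).trans_eq ?_
  ring

theorem expectedProfit₂_eq (E : EquilibriumData z₁ z₂ w π G H) (p : ℝ) :
    expectedProfit₂ z₁ z₂ (strategy₁ z₁ z₂ w π G) p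
      = (∫ s in (z₁ - w)..z₁, profit 1 z₂ p z₁ s
          * (lam z₂ * (G s - 1) + 2 * lam z₂ * π / (s + (z₂ - z₁)) ^ 2))
        + (1 - G z₁) * profit 1 z₂ p z₁ (1 - z₁) :=
  integral_densityWithAtom (by linarith [E.w_pos]) E.continuousOn_G_density E.G_density_nonneg
    (by linarith [E.G_right_le]) (measurable_profit_right ..) fun _ => abs_profit_le ..

theorem expectedProfit₂_mono (E : EquilibriumData z₁ z₂ w π G H) {p q : ℝ}
    (h : ∀ s ∈ Set.Ioo (z₁ - w) z₁, profit 1 z₂ p z₁ s ≤ profit 1 z₂ q z₁ s)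
    (h' : profit 1 z₂ p z₁ (1 - z₁) ≤ profit 1 z₂ q z₁ (1 - z₁)) :
    expectedProfit₂ z₁ z₂ (strategy₁ z₁ z₂ w π G) p
      ≤ expectedProfit₂ z₁ z₂ (strategy₁ z₁ z₂ w π G) q := by
  have := E.isProbabilityMeasure₁
  exact integral_mono_ae (integrable_profit ..) (integrable_profit ..)
    (ae_densityWithAtom h (Or.inr h'))

/-- The split at `s = p - δ` separates being undercut from sharing. The correction compares the
sharing formula with the actual profit against the atom at `1 - z₁`. -/
theorem expectedProfit₂_support (E : EquilibriumData z₁ z₂ w π G H) {p : ℝ} (hp : z₂ - w ≤ p)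
    (hp' : p ≤ z₂) : expectedProfit₂ z₁ z₂ (strategy₁ z₁ z₂ w π G) p
      = π - (1 - G z₁) * (p * (2 - (p - (1 - z₁) + z₁ + z₂) / 2)
          - profit 1 z₂ p z₁ (1 - z₁)) := by
  have hz := E.lt_z₁
  have hz' := E.z₁_le
  have hzz := E.z₁_lt_z₂
  have hw' := E.w_le
  have h0 : 0 < p := by linarith
  have hw := E.w_pos
  have h1 : z₁ - w ≤ p - (z₂ - z₁) := by linarith
  have h2 : p - (z₂ - z₁) ≤ z₁ := by linarith
  have hm := measurable_profit_right 1 z₂ p z₁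
  have hb : ∀ s, |profit 1 z₂ p z₁ s| ≤ 2 * |p| := fun s => abs_profit_le ..
  rw [E.expectedProfit₂_eq, ← intervalIntegral.integral_add_adjacent_intervals
    (intervalIntegrable_mul_density E.continuousOn_G_density hm hb le_rfl h1 h2)
    (intervalIntegrable_mul_density E.continuousOn_G_density hm hb h1 h2 le_rfl),
    intervalIntegral.integral_congr_Ioo_of_le h1 (g := fun s =>
      (p + 0 * s) * (lam z₂ * (G s - 1) + 2 * lam z₂ * π / (s + (z₂ - z₁)) ^ 2)),
    intervalIntegral.integral_congr_Ioo_of_le h2 (g := fun s =>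
      (p * (2 - (p + z₁ + z₂) / 2) + p / 2 * s)
        * (lam z₂ * (G s - 1) + 2 * lam z₂ * π / (s + (z₂ - z₁)) ^ 2)),
    E.integral_affine_mul_G_density _ _ le_rfl h1 h2,
    E.integral_affine_mul_G_density _ _ h1 h2 le_rfl, E.G_left]
  · have e1 : p - (z₂ - z₁) + (z₂ - z₁) = p := by ring
    have e2 : z₁ + (z₂ - z₁) = z₂ := by ring
    have h3 : z₂ ≠ 0 := by linarith
    have h4 : 2 * π / z₂ = 2 * (1 + (1 - G z₁) * (3 - 2 * z₁ - 2 * z₂) / 2) := by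
      rw [div_eq_iff h3]
      linear_combination 2 * E.π_eq
    have h5 : p / 2 * (2 * π / p) = π := by field_simp
    rw [e1, e2, h4]
    linear_combination h5
  · intro s hs
    simp only
    rw [E.profit₂_shared hp' (by linarith [hs.2]) (by linarith [hs.1])
      (by linarith [hs.2, E.w_le'])]
    ring
  · intro s hs
    simp only
    rw [E.profit₂_undercut_by_rival hp' (by linarith [hs.2])]
    ring

theorem G_monotoneOn (E : EquilibriumData z₁ z₂ w π G H) :
    MonotoneOn G (Set.Icc (z₁ - w) z₁) := by
  refine monotoneOn_of_hasDerivWithinAt_nonneg (convex_Icc _ _)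
    (fun p hp => (E.hasDerivAt_G p hp).continuousAt.continuousWithinAt)
    (fun p hp => (E.hasDerivAt_G p (interior_subset hp)).hasDerivWithinAt)
    (fun p hp => E.G_density_nonneg p (interior_subset hp))

theorem π_ge (E : EquilibriumData z₁ z₂ w π G H) : z₂ ≤ π := by
  have hD : 0 ≤ (1 - G z₁) * (3 - 2 * z₁ - 2 * z₂) :=
    mul_nonneg (by linarith [E.G_right_le]) (by linarith [E.z₁_le, E.z₂_lt])
  rw [E.π_eq]
  nlinarith [E.half_lt_z₂]

/-- Replacing `G` by its larger value `G z₁` on the right of the differential equation gives an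
upper bound for the density that integrates explicitly. -/
theorem G_sub_le (E : EquilibriumData z₁ z₂ w π G H) {q : ℝ} (hq : z₁ - w ≤ q) (hq' : q ≤ z₁) :
    G z₁ - G q ≤ lam z₂ * (z₁ - q) * (2 * (π / (z₂ * (z₂ - w))) - (1 - G z₁)) := by
  have hz := E.lt_z₁
  have hzz := E.z₁_lt_z₂
  have hw := E.w_le
  have hw0 := E.w_pos
  have hl := E.lam_pos
  have hπ := E.π_ge
  have hder : ∀ s ∈ Set.Icc (z₁ - w) z₁, HasDerivAt
      (fun s => G s + 2 * lam z₂ * π * (s + (z₂ - z₁))⁻¹ + lam z₂ * (1 - G z₁) * s)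
      (lam z₂ * (G s - G z₁)) s := by
    intro s hs
    have hy : s + (z₂ - z₁) ≠ 0 := by linarith [hs.1]
    have d1 := ((hasDerivAt_id s).add_const (z₂ - z₁)).fun_inv hy
    refine (((E.hasDerivAt_G s hs).add (d1.const_mul (2 * lam z₂ * π))).add
      ((hasDerivAt_id s).const_mul (lam z₂ * (1 - G z₁)))).congr_deriv ?_
    simp only [id]
    ring
  have hanti : AntitoneOn
      (fun s => G s + 2 * lam z₂ * π * (s + (z₂ - z₁))⁻¹ + lam z₂ * (1 - G z₁) * s)
      (Set.Icc (z₁ - w) z₁) := by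
    refine antitoneOn_of_hasDerivWithinAt_nonpos (convex_Icc _ _)
      (fun p hp => (hder p hp).continuousAt.continuousWithinAt)
      (fun p hp => (hder p (interior_subset hp)).hasDerivWithinAt) fun p hp => ?_
    have hp' := interior_subset hp
    have := E.G_monotoneOn hp' ⟨by linarith, le_rfl⟩ hp'.2
    exact mul_nonpos_of_nonneg_of_nonpos hl.le (by linarith)
  have h := hanti ⟨hq, hq'⟩ ⟨by linarith, le_rfl⟩ hq'
  simp only [show z₁ + (z₂ - z₁) = z₂ by ring] at h
  have hy : 0 < q + (z₂ - z₁) := by linarith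
  have hz2 : 0 < z₂ := by linarith
  have ha : 0 < z₂ - w := by linarith
  have e : (q + (z₂ - z₁))⁻¹ - z₂⁻¹ = (z₁ - q) / (z₂ * (q + (z₂ - z₁))) := by
    field_simp
    ring
  have e' : (z₁ - q) / (z₂ * (q + (z₂ - z₁))) ≤ (z₁ - q) / (z₂ * (z₂ - w)) := by
    have : 0 ≤ z₁ - q := by linarith
    gcongr
    linarith
  have e3 : 2 * lam z₂ * π * ((q + (z₂ - z₁))⁻¹ - z₂⁻¹)
      ≤ 2 * lam z₂ * π * ((z₁ - q) / (z₂ * (z₂ - w))) := by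
    rw [e]
    have : 0 ≤ π := by linarith
    gcongr
  have e4 : lam z₂ * (z₁ - q) * (2 * (π / (z₂ * (z₂ - w))) - (1 - G z₁))
      = 2 * lam z₂ * π * ((z₁ - q) / (z₂ * (z₂ - w))) - lam z₂ * (1 - G z₁) * (z₁ - q) := by
    ring
  rw [e4]
  linarith

theorem expectedProfit₂_low_aux (E : EquilibriumData z₁ z₂ w π G H) {p q : ℝ} (hp : 0 ≤ p)
    (hp' : p ≤ 1 - z₂) (hq : z₁ - w ≤ q) (hq' : q ≤ z₁)
    (h1 : ∀ s ∈ Set.Ioo (z₁ - w) q, s < p + (z₂ - z₁))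
    (h2 : ∀ s ∈ Set.Ioo q z₁, p + (z₂ - z₁) ≤ s) :
    expectedProfit₂ z₁ z₂ (strategy₁ z₁ z₂ w π G) p
      ≤ p * (z₂ - 1 / 2 - w / 2 + (1 - G z₁) * z₁ + π / (z₂ - w)
        + G z₁ * ((1 - z₂ - p) / 2) + z₁ * (G z₁ - G q)) := by
  have hz := E.lt_z₁
  have hz' := E.z₁_le
  have hzz := E.z₁_lt_z₂
  have hw := E.w_le
  have hw' := E.w_le'
  have hw0 := E.w_pos
  have hm := measurable_profit_right 1 z₂ p z₁
  have hb : ∀ s, |profit 1 z₂ p z₁ s| ≤ 2 * |p| := fun s => abs_profit_le ..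
  have haff : ∀ A B x y : ℝ, z₁ - w ≤ x → x ≤ y → y ≤ z₁ → IntervalIntegrable (fun s =>
      (A + B * s) * (lam z₂ * (G s - 1) + 2 * lam z₂ * π / (s + (z₂ - z₁)) ^ 2)) volume x y := by
    intro A B x y hx hxy hy
    apply ContinuousOn.intervalIntegrable
    rw [Set.uIcc_of_le hxy]
    exact ((by fun_prop : ContinuousOn (fun s => A + B * s) _).mul
      E.continuousOn_G_density).mono (Set.Icc_subset_Icc hx hy)
  have b1 : ∫ s in (z₁ - w)..q, profit 1 z₂ p z₁ s
        * (lam z₂ * (G s - 1) + 2 * lam z₂ * π / (s + (z₂ - z₁)) ^ 2)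
      ≤ ∫ s in (z₁ - w)..q, (p * (2 - (p + z₁ + z₂) / 2) + p / 2 * s)
        * (lam z₂ * (G s - 1) + 2 * lam z₂ * π / (s + (z₂ - z₁)) ^ 2) := by
    refine intervalIntegral.integral_mono_on_of_le_Ioo hq
      (intervalIntegrable_mul_density E.continuousOn_G_density hm hb le_rfl hq hq')
      (haff _ _ _ _ le_rfl hq hq') fun s hs => ?_
    refine mul_le_mul_of_nonneg_right ?_ (E.G_density_nonneg s ⟨hs.1.le, hs.2.le.trans hq'⟩)
    refine (E.profit₂_le_shared hp (by linarith [hs.1]) (h1 s hs)).trans_eq ?_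
    ring
  -- The majorant of `2 * p` keeps the slope `p / 2` of the sharing formula, so the two pieces
  -- differ only by the jump `p * z₁`, which contributes `p * z₁ * (G z₁ - G q)`.
  have b2 : ∫ s in q..z₁, profit 1 z₂ p z₁ s
        * (lam z₂ * (G s - 1) + 2 * lam z₂ * π / (s + (z₂ - z₁)) ^ 2)
      ≤ ∫ s in q..z₁, (p * (2 - (p + z₁ + z₂) / 2 + z₁) + p / 2 * s)
        * (lam z₂ * (G s - 1) + 2 * lam z₂ * π / (s + (z₂ - z₁)) ^ 2) := by
    refine intervalIntegral.integral_mono_on_of_le_Ioo hq'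
      (intervalIntegrable_mul_density E.continuousOn_G_density hm hb hq hq' le_rfl)
      (haff _ _ _ _ hq hq' le_rfl) fun s hs => ?_
    refine mul_le_mul_of_nonneg_right ?_ (E.G_density_nonneg s ⟨hq.trans hs.1.le, hs.2.le⟩)
    refine (profit_le_two_mul hp).trans ?_
    have : 0 ≤ p * ((s - (p + (z₂ - z₁))) / 2) := mul_nonneg hp (by linarith [h2 s hs])
    linarith
  have b3 : (1 - G z₁) * profit 1 z₂ p z₁ (1 - z₁) ≤ (1 - G z₁) * (2 * p) :=
    mul_le_mul_of_nonneg_left (profit_le_two_mul hp) (by linarith [E.G_right_le])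
  rw [E.expectedProfit₂_eq, ← intervalIntegral.integral_add_adjacent_intervals
    (intervalIntegrable_mul_density E.continuousOn_G_density hm hb le_rfl hq hq')
    (intervalIntegrable_mul_density E.continuousOn_G_density hm hb hq hq' le_rfl)]
  refine (add_le_add (add_le_add b1 b2) b3).trans_eq ?_
  rw [E.integral_affine_mul_G_density _ _ le_rfl hq hq',
    E.integral_affine_mul_G_density _ _ hq hq' le_rfl, E.G_left]
  have e1 : z₁ - w + (z₂ - z₁) = z₂ - w := by ring
  have e2 : z₁ + (z₂ - z₁) = z₂ := by ring
  have h3 : z₂ ≠ 0 := by linarith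
  have h4 : 2 * π / z₂ = 2 * (1 + (1 - G z₁) * (3 - 2 * z₁ - 2 * z₂) / 2) := by
    rw [div_eq_iff h3]
    linear_combination 2 * E.π_eq
  rw [e1, e2, h4]
  ring

theorem expectedProfit₂_low (E : EquilibriumData z₁ z₂ w π G H) {p : ℝ} (hp : 0 ≤ p)
    (hp' : p ≤ 1 - z₂) : expectedProfit₂ z₁ z₂ (strategy₁ z₁ z₂ w π G) p ≤ π := by
  have hz := E.lt_z₁
  have hz' := E.z₁_le
  have hzz := E.z₁_lt_z₂
  have hw := E.w_le
  have hw' := E.w_le'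
  have hw0 := E.w_pos
  have hl := E.lam_pos
  have hG1 := E.G_right_le
  have hG0 : 0 ≤ G z₁ := by
    have := E.G_monotoneOn ⟨le_rfl, by linarith⟩ ⟨by linarith, le_rfl⟩
      (show z₁ - w ≤ z₁ by linarith)
    rwa [E.G_left] at this
  -- The undercutting threshold `p + δ`, clamped to the interval on which Firm 1's price has a
  -- density.
  set q := max (z₁ - w) (min z₁ (p + (z₂ - z₁))) with hqdef
  have hq : z₁ - w ≤ q := le_max_left _ _
  have hq' : q ≤ z₁ := max_le (by linarith) (min_le_left _ _)
  have hqx : z₁ - q ≤ 1 - z₂ - p := by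
    have h1 : min z₁ (p + (z₂ - z₁)) ≤ q := le_max_right _ _
    rcases min_choice z₁ (p + (z₂ - z₁)) with h | h <;> rw [h] at h1 <;> linarith
  refine (E.expectedProfit₂_low_aux hp hp' hq hq' ?_ ?_).trans ?_
  · intro s hs
    have h1 : s < z₁ - w ∨ s < min z₁ (p + (z₂ - z₁)) := lt_max_iff.1 hs.2
    rcases h1 with h1 | h1
    · linarith [hs.1]
    · exact h1.trans_le (min_le_right _ _)
  · intro s hs
    have h1 : min z₁ (p + (z₂ - z₁)) < s := (max_lt_iff.1 hs.1).2
    rcases min_lt_iff.1 h1 with h1 | h1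
    · linarith [hs.2]
    · exact h1.le
  set x := 1 - z₂ - p with hx
  have hx0 : 0 ≤ x := by linarith
  set m := 1 - G z₁ with hmdef
  have hGm : G z₁ = 1 - m := by rw [hmdef]; ring
  have hm0 : 0 ≤ m := by linarith
  have hm1 : m ≤ 1 := by linarith
  have ha : 0 < z₂ - w := by linarith
  have hz2 : 0 < z₂ := by linarith
  set Y := π / (z₂ * (z₂ - w)) with hY
  have hY1 : 1 ≤ Y := by
    rw [hY, le_div_iff₀ (by positivity)]
    nlinarith [E.π_ge, E.z₂_lt]
  have hYa : π / (z₂ - w) = z₂ * Y := by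
    rw [hY]
    field_simp
  have hGq := E.G_sub_le hq hq'
  have hGα := E.G_sub_le le_rfl (show z₁ - w ≤ z₁ by linarith)
  rw [E.G_left, ← hmdef, ← hY] at hGα
  rw [← hmdef, ← hY] at hGq
  have hdev := E.deviation
  rw [← hmdef, hYa] at hdev
  rw [hYa]
  have hlam := E.one_sub_eq
  have h2z : 0 < 1 - z₂ := by linarith [E.z₂_lt]
  have k1 : (1 - z₂) * G z₁ ≤ w * Y := by
    have := mul_le_mul_of_nonneg_left hGα h2z.le
    have e : (1 - z₂) * (lam z₂ * (z₁ - (z₁ - w)) * (2 * Y - m)) = w * (Y - m / 2) := by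
      linear_combination (w * (Y - m / 2)) * hlam
    rw [e] at this
    nlinarith
  have k2 : p * (G z₁ - G q) ≤ x * (Y - m / 2) := by
    have hpl : p * (2 * lam z₂) ≤ 1 := by
      rw [← hlam]
      gcongr
    calc p * (G z₁ - G q) ≤ p * (lam z₂ * (z₁ - q) * (2 * Y - m)) :=
          mul_le_mul_of_nonneg_left hGq hp
      _ = (p * (2 * lam z₂)) * ((z₁ - q) * (Y - m / 2)) := by ring
      _ ≤ 1 * (x * (Y - m / 2)) := by
          have : 0 ≤ Y - m / 2 := by linarith
          have : 0 ≤ z₁ - q := by linarith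
          gcongr
      _ = _ := one_mul _
  have k3 : p * (G z₁ * (x / 2)) ≤ x * (w * Y) / 2 := by
    calc p * (G z₁ * (x / 2)) ≤ (1 - z₂) * (G z₁ * (x / 2)) := by gcongr
      _ = x / 2 * ((1 - z₂) * G z₁) := by ring
      _ ≤ x / 2 * (w * Y) := by gcongr
      _ = _ := by ring
  have k4 : z₁ * (p * (G z₁ - G q)) ≤ z₁ * (x * (Y - m / 2)) := by gcongr
  -- Lowering the price by `x` below `1 - z₂` loses an amount linear in `x`. The gains are at most
  -- those in `k3` and `k4`; `k5`, `k6` and `k7` show that the loss outweighs them, using `w / 2 ≤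
  -- z₂ - 1 / 2 ≤ z₂ - z₁`.
  have k5 : 0 ≤ x * ((z₂ - z₁ - w / 2) * Y) :=
    mul_nonneg hx0 (mul_nonneg (by linarith) (by linarith))
  have k6 : 0 ≤ x * (z₂ - 1 / 2 - w / 2) := mul_nonneg hx0 (by linarith)
  have k7 : 0 ≤ x * (m * z₁) := mul_nonneg hx0 (mul_nonneg hm0 (by linarith))
  have hpx : p = 1 - z₂ - x := by rw [hx]; ring
  have e : p * (z₂ - 1 / 2 - w / 2 + m * z₁ + z₂ * Y)
      = (1 - z₂) * (z₂ - 1 / 2 - w / 2 + m * z₁ + z₂ * Y)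
        - x * (z₂ - 1 / 2 - w / 2 + m * z₁ + z₂ * Y) := by
    rw [hpx]; ring
  linarith

theorem expectedProfit₂_le_of_support (E : EquilibriumData z₁ z₂ w π G H) {p : ℝ}
    (hp : z₂ - w ≤ p) (hp' : p ≤ z₂) (hp2 : 1 - z₂ < p) :
    expectedProfit₂ z₁ z₂ (strategy₁ z₁ z₂ w π G) p ≤ π := by
  rw [E.expectedProfit₂_support hp hp']
  have h := E.profit₂_le_shared (p := p) (s := 1 - z₁) (by linarith [E.z₂_lt])
    (by linarith [E.z₁_le]) (by linarith)
  have := mul_nonneg (show 0 ≤ 1 - G z₁ by linarith [E.G_right_le]) (sub_nonneg.2 h)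
  linarith

/-- Between `1 - z₂` and the interval the market is shared with every rival price, so raising the
price to `z₂ - w` helps; above `z₂` the captives are lost. -/
theorem expectedProfit₂_le (E : EquilibriumData z₁ z₂ w π G H) (p : ℝ) :
    expectedProfit₂ z₁ z₂ (strategy₁ z₁ z₂ w π G) p ≤ π := by
  have hz := E.lt_z₁
  have hz' := E.z₁_le
  have hzz := E.z₁_lt_z₂
  have hw := E.w_le
  have hw' := E.w_le'
  have hw0 := E.w_pos
  have hh := E.half_lt_z₂
  have h2 := E.z₂_lt
  have hπ := E.π_ge
  rcases le_total p 0 with h0 | h0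
  · exact (integral_profit_nonpos h0).trans (by linarith)
  rcases le_or_gt p (1 - z₂) with h1 | h1
  · exact E.expectedProfit₂_low h0 h1
  rcases le_or_gt p z₂ with h3 | h3
  · rcases le_or_gt (z₂ - w) p with h4 | h4
    · exact E.expectedProfit₂_le_of_support h4 h3 h1
    refine le_trans ?_ (E.expectedProfit₂_le_of_support (p := z₂ - w) le_rfl (by linarith)
      (by linarith))
    have key : ∀ s, 0 < s → p * (2 - (p - s + z₁ + z₂) / 2)
        ≤ (z₂ - w) * (2 - (z₂ - w - s + z₁ + z₂) / 2) := by
      intro s hs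
      have : 0 ≤ (z₂ - w - p) * (2 + (s - z₁ - z₂ - (p + (z₂ - w))) / 2) :=
        mul_nonneg (by linarith) (by linarith)
      nlinarith
    refine E.expectedProfit₂_mono (fun s hs => ?_) ?_
    · rw [E.profit₂_shared h3 (by linarith [hs.2]) (by linarith [hs.1]) (by linarith [hs.2]),
        E.profit₂_shared (by linarith) (by linarith [hs.2]) (by linarith [hs.1])
          (by linarith [hs.2])]
      exact key s (by linarith [hs.1])
    · rw [E.profit₂_shared h3 le_rfl (by linarith) (by linarith),
        E.profit₂_shared (by linarith) le_rfl (by linarith) (by linarith)]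
      exact key _ (by linarith)
  · refine le_trans ?_ (E.expectedProfit₂_le_of_support (p := z₂) (by linarith) le_rfl
      (by linarith))
    have key : ∀ s, profit 1 z₂ p z₁ s ≤ profit 1 z₂ z₂ z₁ s := by
      intro s
      rw [profit₂_reflect, profit₂_reflect]
      have := profit_le_profit_captive_price (x := 1 - z₂) (p := p) (y := 1 - z₁) (q := s)
        (by linarith) (by linarith) (by linarith)
      rwa [sub_sub_cancel] at this
    exact E.expectedProfit₂_mono (fun s _ => key s) (key _)

theorem ae_expectedProfit₂ (E : EquilibriumData z₁ z₂ w π G H) :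
    ∀ᵐ p ∂strategy₂ z₁ z₂ w H, expectedProfit₂ z₁ z₂ (strategy₁ z₁ z₂ w π G) p = π := by
  have hw' := E.w_le'
  have hw0 := E.w_pos
  have hz := E.lt_z₁
  have hh := E.half_lt_z₂
  have key : ∀ p, z₂ - w ≤ p → p ≤ z₂ → 1 - z₂ < p → p < 1 - z₁ + (z₂ - z₁) →
      expectedProfit₂ z₁ z₂ (strategy₁ z₁ z₂ w π G) p = π := by
    intro p h1 h2 h3 h4
    rw [E.expectedProfit₂_support h1 h2, E.profit₂_shared h2 le_rfl h4 (by linarith)]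
    ring
  refine ae_densityWithAtom (fun p hp => ?_) ?_
  · exact key p hp.1.le hp.2.le (by linarith [hp.1]) (by linarith [hp.2, E.z₁_le])
  -- The two atoms tie only for `z₁ = 1 / 2`, when Firm 2's atom has mass zero.
  · rcases E.z₁_le.eq_or_lt with hz' | hz'
    · left
      have h := E.H_right
      have h2 : 1 - z₂ ≠ 0 := by linarith [E.z₂_lt]
      apply mul_left_cancel₀ h2
      rw [hz'] at h
      norm_num at h
      linarith
    · exact Or.inr (key z₂ (by linarith) le_rfl (by linarith) (by linarith))

theorem isPriceEquilibrium (E : EquilibriumData z₁ z₂ w π G H) :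
    IsPriceEquilibrium z₁ z₂ (strategy₁ z₁ z₂ w π G) (strategy₂ z₁ z₂ w H) (2 * (z₁ - w)) π := by
  have h1 := E.isProbabilityMeasure₁
  have h2 := E.isProbabilityMeasure₂
  exact {
    isProbabilityMeasure₁ := h1
    isProbabilityMeasure₂ := h2
    integrable_profit₁ := fun _ => integrable_profit ..
    integrable_profit₂ := fun _ => integrable_profit ..
    integrable_expectedProfit₁ := (integrable_const _).congr (E.ae_expectedProfit₁.mono
      fun _ h => h.symm)
    integrable_expectedProfit₂ := (integrable_const _).congr (E.ae_expectedProfit₂.mono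
      fun _ h => h.symm)
    payoff₁ := by
      rw [integral_congr_ae E.ae_expectedProfit₁]
      simp
    payoff₂ := by
      rw [integral_congr_ae E.ae_expectedProfit₂]
      simp
    no_deviation₁ := E.expectedProfit₁_le
    no_deviation₂ := E.expectedProfit₂_le }

end EquilibriumData

end CaptiveHotelling

namespace CaptiveHotelling

/-! ### Bounds from the differential equations -/

theorem hasDerivAt_exp_mul (k p : ℝ) :
    HasDerivAt (fun p => Real.exp (k * p)) (Real.exp (k * p) * k) p := by
  simpa using ((hasDerivAt_id p).const_mul k).exp

section G

variable {G : ℝ → ℝ} {l π δ a b : ℝ}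

/-- Freezing the forcing term at its smallest value, at `b`, gives a constant-coefficient inequality
for the survival function `1 - G`, solved by an integrating factor. -/
theorem survival_lower_bound (ha : 0 < a + δ) (hab : a ≤ b) (hl : 0 ≤ l) (hπ : 0 ≤ π)
    (hG : ∀ p ∈ Set.Icc a b, HasDerivAt G (l * (G p - 1) + 2 * l * π / (p + δ) ^ 2) p) :
    (1 - G b - 2 * π / (b + δ) ^ 2) * Real.exp (-l * (b - a)) ≤ 1 - G a - 2 * π / (b + δ) ^ 2 := by
  have hder : ∀ p ∈ Set.Icc a b, HasDerivAt
      (fun p => (1 - G p - 2 * π / (b + δ) ^ 2) * Real.exp (-l * p))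
      (l * (2 * π / (b + δ) ^ 2 - 2 * π / (p + δ) ^ 2) * Real.exp (-l * p)) p := by
    intro p hp
    refine ((((hG p hp).const_sub 1).sub_const (2 * π / (b + δ) ^ 2)).mul
      (hasDerivAt_exp_mul (-l) p)).congr_deriv ?_
    ring
  have hanti : AntitoneOn (fun p => (1 - G p - 2 * π / (b + δ) ^ 2) * Real.exp (-l * p))
      (Set.Icc a b) := by
    refine antitoneOn_of_hasDerivWithinAt_nonpos (convex_Icc _ _)
      (fun p hp => (hder p hp).continuousAt.continuousWithinAt)
      (fun p hp => (hder p (interior_subset hp)).hasDerivWithinAt) fun p hp => ?_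
    have hp' := interior_subset hp
    have h1 : 0 < p + δ := by linarith [hp'.1]
    have h2 : 2 * π / (b + δ) ^ 2 ≤ 2 * π / (p + δ) ^ 2 := by
      have := hp'.2
      gcongr
    exact mul_nonpos_of_nonpos_of_nonneg (mul_nonpos_of_nonneg_of_nonpos hl (by linarith))
      (Real.exp_pos _).le
  have h := hanti ⟨le_rfl, hab⟩ ⟨hab, le_rfl⟩ hab
  simp only at h
  have e : Real.exp (-l * b) = Real.exp (-l * (b - a)) * Real.exp (-l * a) := by
    rw [← Real.exp_add]; ring_nf
  rw [e, ← mul_assoc] at h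
  exact le_of_mul_le_mul_right h (Real.exp_pos _)

/-- Times `exp (-l * p)`, the negative of the density over `l` is nondecreasing, so nonpositivity at
`b` spreads to the left. -/
theorem density_nonneg_of_right (ha : 0 < a + δ) (hl : 0 ≤ l) (hπ : 0 ≤ π)
    (hG : ∀ p ∈ Set.Icc a b, HasDerivAt G (l * (G p - 1) + 2 * l * π / (p + δ) ^ 2) p)
    (hb : 1 - G b ≤ 2 * π / (b + δ) ^ 2) :
    ∀ p ∈ Set.Icc a b, 0 ≤ l * (G p - 1) + 2 * l * π / (p + δ) ^ 2 := by
  have hder : ∀ p ∈ Set.Icc a b, HasDerivAt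
      (fun p => (1 - G p - 2 * π * ((p + δ)⁻¹) ^ 2) * Real.exp (-l * p))
      (4 * π * ((p + δ)⁻¹) ^ 3 * Real.exp (-l * p)) p := by
    intro p hp
    have hy : p + δ ≠ 0 := by linarith [hp.1]
    have d1 : HasDerivAt (fun p => 2 * π * ((p + δ)⁻¹) ^ 2) (-(4 * π) * ((p + δ)⁻¹) ^ 3) p := by
      refine (((((hasDerivAt_id p).add_const δ).fun_inv hy).fun_pow 2).const_mul
        (2 * π)).congr_deriv ?_
      simp only [id]
      norm_num
      field_simp
      ring
    have d2 := hG p hp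
    rw [div_eq_mul_inv, ← inv_pow] at d2
    refine (((d2.const_sub 1).sub d1).mul (hasDerivAt_exp_mul (-l) p)).congr_deriv ?_
    simp only [Pi.sub_apply]
    ring
  have hmono : MonotoneOn (fun p => (1 - G p - 2 * π * ((p + δ)⁻¹) ^ 2) * Real.exp (-l * p))
      (Set.Icc a b) := by
    refine monotoneOn_of_hasDerivWithinAt_nonneg (convex_Icc _ _)
      (fun p hp => (hder p hp).continuousAt.continuousWithinAt)
      (fun p hp => (hder p (interior_subset hp)).hasDerivWithinAt) fun p hp => ?_
    have hp' := interior_subset hp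
    have h1 : 0 < p + δ := by linarith [hp'.1]
    positivity
  intro p hp
  have h := hmono hp ⟨hp.1.trans hp.2, le_rfl⟩ hp.2
  simp only at h
  have hb' : 1 - G b - 2 * π * ((b + δ)⁻¹) ^ 2 ≤ 0 := by
    rw [inv_pow, ← div_eq_mul_inv]
    linarith
  have h2 := h.trans (mul_nonpos_of_nonpos_of_nonneg hb' (Real.exp_pos _).le)
  have h3 : 1 - G p - 2 * π * ((p + δ)⁻¹) ^ 2 ≤ 0 := by
    by_contra! hc
    exact absurd h2 (not_le.2 (mul_pos hc (Real.exp_pos _)))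
  have e : l * (G p - 1) + 2 * l * π / (p + δ) ^ 2
      = l * (-(1 - G p - 2 * π * ((p + δ)⁻¹) ^ 2)) := by
    rw [inv_pow]; ring
  rw [e]
  exact mul_nonneg hl (by linarith)

end G

section H

variable {H : ℝ → ℝ} {l α δ a b : ℝ}

theorem density_nonneg_of_right' (ha : 0 < a - δ) (hl : 0 ≤ l)
    (hH : ∀ p ∈ Set.Icc a b, HasDerivAt H (4 * l * α / (p - δ) ^ 2 - l * H p) p)
    (hb : H b ≤ 4 * α / (b - δ) ^ 2) (hα : 0 ≤ α) :
    ∀ p ∈ Set.Icc a b, 0 ≤ 4 * l * α / (p - δ) ^ 2 - l * H p := by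
  have hder : ∀ p ∈ Set.Icc a b, HasDerivAt
      (fun p => (H p - 4 * α * ((p - δ)⁻¹) ^ 2) * Real.exp (l * p))
      (8 * α * ((p - δ)⁻¹) ^ 3 * Real.exp (l * p)) p := by
    intro p hp
    have hy : p - δ ≠ 0 := by linarith [hp.1]
    have d1 : HasDerivAt (fun p => 4 * α * ((p - δ)⁻¹) ^ 2) (-(8 * α) * ((p - δ)⁻¹) ^ 3) p := by
      refine (((((hasDerivAt_id p).sub_const δ).fun_inv hy).fun_pow 2).const_mul
        (4 * α)).congr_deriv ?_
      simp only [id]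
      norm_num
      field_simp
      ring
    have d2 := hH p hp
    rw [div_eq_mul_inv, ← inv_pow] at d2
    refine ((d2.sub d1).mul (hasDerivAt_exp_mul l p)).congr_deriv ?_
    simp only [Pi.sub_apply]
    ring
  have hmono : MonotoneOn (fun p => (H p - 4 * α * ((p - δ)⁻¹) ^ 2) * Real.exp (l * p))
      (Set.Icc a b) := by
    refine monotoneOn_of_hasDerivWithinAt_nonneg (convex_Icc _ _)
      (fun p hp => (hder p hp).continuousAt.continuousWithinAt)
      (fun p hp => (hder p (interior_subset hp)).hasDerivWithinAt) fun p hp => ?_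
    have hp' := interior_subset hp
    have h1 : 0 < p - δ := by linarith [hp'.1]
    positivity
  intro p hp
  have h := hmono hp ⟨hp.1.trans hp.2, le_rfl⟩ hp.2
  simp only at h
  have hb' : H b - 4 * α * ((b - δ)⁻¹) ^ 2 ≤ 0 := by
    rw [inv_pow, ← div_eq_mul_inv]
    linarith
  have h2 := h.trans (mul_nonpos_of_nonpos_of_nonneg hb' (Real.exp_pos _).le)
  have h3 : H p - 4 * α * ((p - δ)⁻¹) ^ 2 ≤ 0 := by
    by_contra! hc
    exact absurd h2 (not_le.2 (mul_pos hc (Real.exp_pos _)))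
  have e : 4 * l * α / (p - δ) ^ 2 - l * H p
      = l * (-(H p - 4 * α * ((p - δ)⁻¹) ^ 2)) := by
    rw [inv_pow]; ring
  rw [e]
  exact mul_nonneg hl (by linarith)

end H

/-! ### Values at the ends of the supports -/

variable {z₁ z₂ w : ℝ}

theorem g₀_self : g₀ z₁ z₂ z₁ z₁ = 1 + 2 / (3 - 2 * z₁ - 2 * z₂) := by
  unfold g₀
  rw [sub_self, mul_zero, Real.exp_zero, mul_one]
  ring_nf

theorem gπ_self (h0 : z₂ ≠ 0) (h1 : 1 - z₂ ≠ 0) (hD : 3 - 2 * z₁ - 2 * z₂ ≠ 0) :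
    gπ z₁ z₂ z₁ z₁ = 2 / (z₂ * (3 - 2 * z₁ - 2 * z₂)) := by
  unfold gπ dist₁₂ lam
  rw [sub_self, sub_self, mul_zero, mul_zero, Real.exp_zero, mul_one, sub_zero,
    show z₁ + (z₂ - z₁) = z₂ by ring, show 3 - z₁ - 2 * z₂ - z₁ = 3 - 2 * z₁ - 2 * z₂ by ring]
  field_simp
  ring

theorem h_self {a : ℝ} (ha : a - dist₁₂ z₁ z₂ ≠ 0) : h z₁ z₂ a a = 0 := by
  unfold h
  rw [sub_self, sub_self, mul_zero, mul_zero, Real.exp_zero, mul_div_cancel_right₀ _ ha]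
  ring

/-- The survival function of Firm 1's price can fall from `1` to a nonnegative value over an
interval of length `w` only if `w` is small. -/
theorem width_le {l : ℝ} (hl : (1 - z₂) * (2 * l) = 1) (hl0 : 0 < l) (h1 : z₂ < 1)
    (hw' : w ≤ 2 * z₂ - 1) (hw0 : 0 < w) (h : 1 - Real.exp (-l * w) ≤ z₂ / 2) : w ≤ 9 / 28 := by
  by_contra! hw
  set u := 1 - z₂ with hu
  have hu0 : 0 < u := by linarith
  set x := l * w with hx
  have hx0 : 0 < x := by positivity
  have hxu : x * u = w / 2 := by rw [hx]; linear_combination (w / 2) * hl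
  have h2 := Real.quadratic_le_exp_of_nonneg hx0.le
  have h3 : Real.exp (-l * w) * Real.exp x = 1 := by
    rw [← Real.exp_add, hx]; simp
  have h4 : (1 + u) / 2 ≤ Real.exp (-l * w) := by linarith
  have h5 : (1 + u) / 2 * (1 + x + x ^ 2 / 2) ≤ 1 := by
    calc (1 + u) / 2 * (1 + x + x ^ 2 / 2) ≤ Real.exp (-l * w) * Real.exp x := by gcongr
      _ = 1 := h3
  -- Multiplying by `u ^ 2` makes the inequality polynomial in `u` and `w`, since `x * u = w / 2`.
  have h6 : (1 + u) * (u ^ 2 + (x * u) * u + (x * u) ^ 2 / 2) ≤ 2 * u ^ 2 := by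
    have := mul_le_mul_of_nonneg_right h5 (show 0 ≤ 2 * u ^ 2 by positivity)
    linarith
  rw [hxu] at h6
  have hu1 : u ≤ 19 / 56 := by linarith
  have h7 : (9 / 28 : ℝ) ^ 2 ≤ w ^ 2 := by gcongr
  have h8 : (1 + u) * (u ^ 2 + (9 / 56) * u + (9 / 56) ^ 2 / 2) ≤ 2 * u ^ 2 := by
    refine le_trans ?_ h6
    gcongr ?_ * (_ + ?_ * _ + ?_ ^ 2 / 2)
    · linarith
    · linarith
  -- The root `1 / 2` matches the quadratic coefficient `-47 / 56` of the cubic in `h8`; the rest of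
  -- that cubic is `(25 * u + 81) / 6272`, which is positive.
  have h9 : 0 ≤ u * ((19 / 56 - u) * (1 / 2 - u)) :=
    mul_nonneg hu0.le (mul_nonneg (by linarith) (by linarith))
  nlinarith

theorem deviation_identity {π : ℝ} (h0 : z₂ ≠ 0) (h1 : 1 - z₂ ≠ 0) (ha : z₂ - w ≠ 0)
    (hD : 3 - 2 * z₁ - 2 * z₂ ≠ 0) :
    (1 - z₂) * (z₂ - 1 / 2 - w / 2 + 2 / (3 - 2 * z₁ - 2 * z₂) * (π / z₂ - 1) * z₁ + π / (z₂ - w))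
        - π
      = (1 - z₂) * (2 - w / 2 - (3 / 2 - z₂) * (1 + 2 / (3 - 2 * z₁ - 2 * z₂))
        + (w / (z₂ * (z₂ - w)) + (3 / 2 - z₂) * (2 / (z₂ * (3 - 2 * z₁ - 2 * z₂)))
          - 1 / (1 - z₂)) * π) := by
  have e1 : (1 - z₂) * (1 / (1 - z₂)) = 1 := mul_one_div_cancel h1
  have e2 : w / (z₂ * (z₂ - w)) = 1 / (z₂ - w) - 1 / z₂ := by
    field_simp
    ring
  have e3 : 2 / (z₂ * (3 - 2 * z₁ - 2 * z₂)) = 2 / (3 - 2 * z₁ - 2 * z₂) * (1 / z₂) := by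
    field_simp
  have e4 : 2 / (3 - 2 * z₁ - 2 * z₂) * (3 - 2 * z₁ - 2 * z₂) = 2 := div_mul_cancel₀ _ hD
  have e5 : π / z₂ = π * (1 / z₂) := by ring
  have e6 : π / (z₂ - w) = π * (1 / (z₂ - w)) := by ring
  rw [e2, e3, e5, e6]
  generalize 2 / (3 - 2 * z₁ - 2 * z₂) = d at *
  generalize 1 / z₂ = r at *
  linear_combination π * e1 + (1 - z₂) * (1 - π * r) / 2 * e4

/-- Otherwise `1 - z₂` exceeds `z₂ - w`, and the term `(1 - z₂) * π / (z₂ - w)` alone overshoots `π`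
by more than the possibly negative remainder can offset. -/
theorem width_le_of_deviation {π c : ℝ} (hw : 0 < w) (h0 : 0 < z₂)
    (ha : 0 < z₂ - w)
    (hπ : z₂ ≤ π) (hc : 0 ≤ c)
    (hdev : (1 - z₂) * (z₂ - 1 / 2 - w / 2 + c + π / (z₂ - w)) ≤ π) : w ≤ 2 * z₂ - 1 := by
  by_contra! hcon
  have e : π / (z₂ - w) * (1 - z₂) = π + π / (z₂ - w) * (w - (2 * z₂ - 1)) := by
    have := ha.ne'
    field_simp
    ring
  have h2 : 1 * (w - (2 * z₂ - 1)) ≤ π / (z₂ - w) * (w - (2 * z₂ - 1)) := by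
    refine mul_le_mul_of_nonneg_right ?_ (by linarith)
    rw [le_div_iff₀ ha]
    linarith
  have h3 : 0 ≤ (1 - z₂) * c := mul_nonneg (by linarith) hc
  have h4 : 0 < z₂ * (w - (2 * z₂ - 1)) := mul_pos h0 (by linarith)
  linarith

/-- For `z₁ ≤ 1 / 2` the left side is nondecreasing in `w`, and at `w = 3 * z₁ / 4` the claim
reduces to `z₁ ≤ 1 / 2`. With `H_right` this gives `H z₂ ≤ 1`. -/
theorem width_sum_le (h0 : 0 < z₁) (h1 : z₁ ≤ 1 / 2) (hw : w ≤ 3 * z₁ / 4) :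
    2 * (z₁ - w) / (1 - z₁) + 2 * w / z₁ ≤ z₁ + 3 / 2 := by
  have h2 : 0 < 1 - z₁ := by linarith
  rw [div_add_div _ _ h2.ne' h0.ne', div_le_iff₀ (by positivity)]
  have k1 := mul_nonneg (show 0 ≤ 3 * z₁ / 4 - w by linarith) (show 0 ≤ 1 - 2 * z₁ by linarith)
  have k2 := mul_nonneg (sq_nonneg z₁) (show 0 ≤ 1 - 2 * z₁ by linarith)
  nlinarith

theorem one_sub_mul_lam (h1 : z₂ < 1) : (1 - z₂) * (2 * lam z₂) = 1 := by
  have : 1 - z₂ ≠ 0 := by linarith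
  unfold lam
  field_simp

theorem lam_pos (h1 : z₂ < 1) : 0 < lam z₂ := by
  unfold lam
  exact one_div_pos.2 (by linarith)

/-! ### Verifying the equilibrium conditions for `g` and `h` -/

theorem equilibriumData_of_ends {π : ℝ} {G H : ℝ → ℝ} (hz₁' : 3 / 7 < z₁) (hz₁ : z₁ ≤ 1 / 2)
    (hz₁₂ : z₁ < z₂) (hz₂ : z₂ < 1) (hδ : z₂ - z₁ ≤ 1 / 2) (hsum : 1 ≤ z₁ + z₂) (hw : 0 < w)
    (hwz : w < z₁)
    (hGd : ∀ p ∈ Set.Icc (z₁ - w) z₁,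
      HasDerivAt G (lam z₂ * (G p - 1) + 2 * lam z₂ * π / (p + (z₂ - z₁)) ^ 2) p)
    (hG_left : G (z₁ - w) = 0) (hG_right : G z₁ ≤ 1) (hπ : z₂ ≤ π)
    (hπ_eq : π = z₂ * (1 + (1 - G z₁) * (3 - 2 * z₁ - 2 * z₂) / 2))
    (hdev : (1 - z₂) * (z₂ - 1 / 2 - w / 2 + (1 - G z₁) * z₁ + π / (z₂ - w)) ≤ π)
    (hHd : ∀ p ∈ Set.Icc (z₂ - w) z₂,
      HasDerivAt H (4 * lam z₂ * (z₁ - w) / (p - (z₂ - z₁)) ^ 2 - lam z₂ * H p) p)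
    (hH_left : H (z₂ - w) = 0)
    (hHr : (1 - z₂) * H z₂ + z₁ + z₂ + 1 / 2 - 2 * w / z₁ = 2 * (z₁ - w) / (1 - z₁)) :
    EquilibriumData z₁ z₂ w π G H := by
  have hz₂0 : 0 < z₂ := by linarith
  have hlam : (1 - z₂) * (2 * lam z₂) = 1 := one_sub_mul_lam hz₂
  have hl0 : 0 < lam z₂ := lam_pos hz₂
  have haw : 0 < z₂ - w := by linarith
  have hm0 : 0 ≤ 1 - G z₁ := by linarith
  have hw' : w ≤ 2 * z₂ - 1 :=
    width_le_of_deviation hw hz₂0 haw hπ (mul_nonneg hm0 (by linarith)) hdev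
  have hsurv := survival_lower_bound (by linarith) (by linarith) hl0.le (by linarith) hGd
  simp only [hG_left, show z₁ + (z₂ - z₁) = z₂ by ring, show z₁ - (z₁ - w) = w by ring,
    sub_zero] at hsurv
  have hC : 2 / z₂ ≤ 2 * π / z₂ ^ 2 := by
    rw [div_le_div_iff₀ hz₂0 (by positivity)]
    nlinarith
  have hC2 : 2 ≤ 2 / z₂ := by
    rw [le_div_iff₀ hz₂0]
    linarith
  have hexp : Real.exp (-lam z₂ * w) ≤ 1 := Real.exp_le_one_iff.2 (by nlinarith)
  -- If this failed, the left side of `hsurv` would be nonnegative, while its right side is at most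
  -- `1 - 2`.
  have hmC : 1 - G z₁ ≤ 2 * π / z₂ ^ 2 := by
    by_contra! hcon
    have := mul_nonneg (show 0 ≤ 1 - G z₁ - 2 * π / z₂ ^ 2 by linarith) (Real.exp_pos (-lam z₂ * w)).le
    linarith
  have hwidth : 1 - Real.exp (-lam z₂ * w) ≤ z₂ / 2 := by
    have h1 : 2 / z₂ * (1 - Real.exp (-lam z₂ * w)) ≤ 1 := by
      have h2 : 2 / z₂ * (1 - Real.exp (-lam z₂ * w))
          ≤ 2 * π / z₂ ^ 2 * (1 - Real.exp (-lam z₂ * w)) :=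
        mul_le_mul_of_nonneg_right hC (by linarith)
      have h3 := mul_nonneg hm0 (Real.exp_pos (-lam z₂ * w)).le
      linarith
    rw [div_mul_eq_mul_div, div_le_one hz₂0] at h1
    linarith
  have hw9 := width_le hlam hl0 hz₂ hw' hw hwidth
  -- Here `9 / 28` is `3 / 4` times the lower bound `3 / 7` of `z₁`.
  have hw3 : w ≤ 3 * z₁ / 4 := by linarith
  have hH1 : H z₂ ≤ 1 := by
    have key := width_sum_le (by linarith) hz₁ hw3
    have : (1 - z₂) * H z₂ ≤ (1 - z₂) * 1 := by linarith
    exact le_of_mul_le_mul_left this (by linarith)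
  have hHb : H z₂ ≤ 4 * (z₁ - w) / (z₂ - (z₂ - z₁)) ^ 2 := by
    refine hH1.trans ?_
    rw [sub_sub_cancel, le_div_iff₀ (by positivity)]
    nlinarith
  exact {
    lt_z₁ := hz₁'
    z₁_le := hz₁
    z₁_lt_z₂ := hz₁₂
    z₂_lt := hz₂
    sub_le := hδ
    one_le_add := hsum
    w_pos := hw
    w_le := hw3
    w_le' := hw'
    hasDerivAt_G := hGd
    G_left := hG_left
    G_right_le := hG_right
    G_density_nonneg := density_nonneg_of_right (by linarith) hl0.le (by linarith) hGd (by
      rw [show z₁ + (z₂ - z₁) = z₂ by ring]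
      exact hmC)
    π_eq := hπ_eq
    deviation := hdev
    hasDerivAt_H := hHd
    H_left := hH_left
    H_right_le := hH1
    H_density_nonneg := density_nonneg_of_right' (by linarith) hl0.le hHd hHb (by linarith)
    H_right := hHr }

theorem equilibriumData (hz₁₂ : z₁ < z₂) (hz₁ : z₁ ≤ 1 / 2) (hsum : 1 ≤ z₁ + z₂)
    (hc : (1 - z₁) * (1 / 2 + z₁ + z₂) < 2 * z₁) (hw : 0 < w) (hwz : w < z₁)
    (hw_eq : 1 / (2 * lam z₂) * h z₁ z₂ z₂ (z₂ - w)
        + z₁ + z₂ + 1 / 2 - 2 * w / z₁ = 2 * (z₁ - w) / (1 - z₁))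
    {π : ℝ} (hπdef : π = g₀ z₁ z₂ (z₁ - w) z₁ / gπ z₁ z₂ (z₁ - w) z₁)
    (hw_cond : 2 - w / 2 - (3 / 2 - z₂) * g₀ z₁ z₂ z₁ z₁
        + (w / (z₂ * (z₂ - w)) + (3 / 2 - z₂) * gπ z₁ z₂ z₁ z₁ - 1 / (1 - z₂)) * π ≤ 0)
    (hw_atom : g z₁ z₂ z₁ z₁ π ≤ 1) :
    EquilibriumData z₁ z₂ w π (fun p => g z₁ z₂ p z₁ π) (fun p => h z₁ z₂ p (z₂ - w)) := by
  -- From `hc` with `z₁ + z₂` replaced by its lower bound `1`; the next bound replaces `1 - z₁` by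
  -- `1 / 2`.
  have hz₁' : 3 / 7 < z₁ := by nlinarith
  have hz₂' : z₂ < 3 * z₁ - 1 / 2 := by nlinarith
  have hz₂ : z₂ < 1 := by linarith
  have hz₂0 : 0 < z₂ := by linarith
  have h1z : 1 - z₂ ≠ 0 := by linarith
  have haw : z₂ - w ≠ 0 := by linarith
  have hl0 := lam_pos hz₂
  have hD : 0 < 3 - 2 * z₁ - 2 * z₂ := by linarith
  have hgπ := gπ_self hz₂0.ne' h1z hD.ne'
  have hm : 1 - g z₁ z₂ z₁ z₁ π = 2 / (3 - 2 * z₁ - 2 * z₂) * (π / z₂ - 1) := by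
    unfold g
    rw [hgπ, g₀_self]
    field_simp
    ring
  have hπ_eq : π = z₂ * (1 + (1 - g z₁ z₂ z₁ z₁ π) * (3 - 2 * z₁ - 2 * z₂) / 2) := by
    rw [hm, mul_right_comm, div_mul_cancel₀ _ hD.ne']
    field_simp
    ring
  have hπ : z₂ ≤ π := by
    have := mul_nonneg hz₂0.le (mul_nonneg (sub_nonneg.2 hw_atom) hD.le)
    linarith
  have hG_left : g z₁ z₂ (z₁ - w) z₁ π = 0 := by
    -- A zero denominator would give `π = 0` by the convention for division by zero, against `z₂ ≤
    -- π`.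
    have hne : gπ z₁ z₂ (z₁ - w) z₁ ≠ 0 := by
      intro h0
      rw [h0, div_zero] at hπdef
      linarith
    rw [g, hπdef, div_mul_cancel₀ _ hne, sub_self]
  refine equilibriumData_of_ends hz₁' hz₁ hz₁₂ hz₂ (by linarith) hsum hw hwz (fun p hp => ?_)
    hG_left hw_atom hπ hπ_eq ?_ (fun p hp => ?_) (h_self (by unfold dist₁₂; linarith)) ?_
  · exact hasDerivAt_g (by unfold dist₁₂; linarith [hp.1]) hl0.ne'
  · have e := deviation_identity (z₁ := z₁) (w := w) (π := π) hz₂0.ne' h1z haw hD.ne'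
    rw [← hgπ, ← g₀_self, ← hm] at e
    have := mul_nonpos_of_nonneg_of_nonpos (show 0 ≤ 1 - z₂ by linarith) hw_cond
    linarith
  · have := hasDerivAt_h (z₁ := z₁) (z₂ := z₂) (p := p) (a := z₂ - w)
      (by unfold dist₁₂; linarith [hp.1]) hl0.ne'
    rwa [show z₂ - w - dist₁₂ z₁ z₂ = z₁ - w by unfold dist₁₂; ring] at this
  · rw [← hw_eq, ← eq_one_div_of_mul_eq_one_left (one_sub_mul_lam hz₂)]

end CaptiveHotelling

end

theorem proposition7 (z₁ z₂ w : ℝ)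
    -- the firms' locations
    (hz₁ : 0 ≤ z₁) (hz₁₂ : z₁ < z₂) (hz₂ : z₂ ≤ 1)
    -- the region of locations
    (hregion_a : z₁ ≤ 1 / 2)
    (hregion_b : 1 ≤ z₁ + z₂)
    (hregion_c : (1 - z₁) * (1 / 2 + z₁ + z₂) < 2 * z₁)
    -- `w` solves the equation for the width of the supports; all prices are positive
    (hw_pos : 0 < w) (hw_lt : w < z₁)
    (hw_eq : 1 / (2 * CaptiveHotelling.lam z₂) * CaptiveHotelling.h z₁ z₂ z₂ (z₂ - w)
        + z₁ + z₂ + 1 / 2 - 2 * w / z₁ = 2 * (z₁ - w) / (1 - z₁))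
    -- the inequality required of `w`
    (hw_cond : 2 - w / 2 - (3 / 2 - z₂) * CaptiveHotelling.g₀ z₁ z₂ z₁ z₁
        + (w / (z₂ * (z₂ - w)) + (3 / 2 - z₂) * CaptiveHotelling.gπ z₁ z₂ z₁ z₁ - 1 / (1 - z₂))
          * (CaptiveHotelling.g₀ z₁ z₂ (z₁ - w) z₁ / CaptiveHotelling.gπ z₁ z₂ (z₁ - w) z₁) ≤ 0)
    -- the mass `1 - g(z₁; z₁, π₂)` that Firm 1 puts on the price `1 - z₁` is nonnegative
    (hw_atom : CaptiveHotelling.g z₁ z₂ z₁ z₁ (CaptiveHotelling.profitStar₂ z₁ z₂ w) ≤ 1) :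
    ∃ μ₁ μ₂ : Measure ℝ,
      IsProbabilityMeasure μ₁ ∧ IsProbabilityMeasure μ₂ ∧
      (∀ p, ProbabilityTheory.cdf μ₁ p = CaptiveHotelling.F₁ z₁ z₂ w p) ∧
      (∀ p, ProbabilityTheory.cdf μ₂ p = CaptiveHotelling.F₂ z₁ z₂ w p) ∧
      CaptiveHotelling.IsPriceEquilibrium z₁ z₂ μ₁ μ₂
        (CaptiveHotelling.profitStar₁ z₁ w) (CaptiveHotelling.profitStar₂ z₁ z₂ w) := by
  have E := CaptiveHotelling.equilibriumData hz₁₂ hregion_a hregion_b hregion_c hw_pos hw_lt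
    hw_eq rfl hw_cond hw_atom
  exact ⟨_, _, E.isProbabilityMeasure₁, E.isProbabilityMeasure₂, E.cdf_strategy₁, E.cdf_strategy₂,
    E.isPriceEquilibrium⟩
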